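/- Let $n\ge 3$. For $1\le i<j\le n$ let $e_{ij}\in\mathfrak{so}(n)$ be the matrix with $-1$ in position $(i,j)$, $1$ in position $(j,i)$ and zeros elsewhere, and let $\langle u,v\rangle=\tfrac12\mathrm{Tr}(uv^{\top})$ be the bi-invariant inner product on $\mathfrak{so}(n)$. A generalized rigid body metric on $SO(n)$ is a left-invariant Riemannian metric generated by an inner product $g(u,v)=\langle u,\Lambda v\rangle$ on $\mathfrak{so}(n)$, where $\Lambda$ is a symmetric operator having every $e_{ij}$ ($i<j$) as an eigenvector. Define $\mathrm{ad}^\star$ by $g(\mathrm{ad}^\star_u v,w)=g(v,[u,w])$. The geodesic $\gamma$ with $\gamma(0)=\mathrm{id}$, $\gamma'(0)=u_0$ is the solution of $\gamma'=\gamma u$, $u'=\mathrm{ad}^\star_u u$, $u(0)=u_0$; it is called steady if $\mathrm{ad}^\star_{u_0}u_0=0$. The Riemannian exponential map is $\exp(u_0)=\gamma(1)$, and $\gamma(\tau)=\exp(\tau u_0)$, $\tau>0$, is a conjugate point along $\gamma$ if the derivative $D\exp(\tau u_0)$ is singular. For every generalized rigid body metric on $SO(n)$, every geodesic from the identity exists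 for all time and is unique, and for all $i<j$ the vector $e_{ij}$ is a steady solution of the Euler–Arnold equation and there is a conjugate point along the corresponding steady geodesic, that is, $D\exp(\tau e_{ij})$ exists and is singular for some $\tau>0$. No curvature assumption is made: for every $n\ge3$ there are generalized rigid body metrics on $SO(n)$ (to which the preceding conclusion applies) with $\mathrm{Ric}(e_{ij},e_{ij})<0$ for some $i<j$. -/

import Mathlib

open Matrix LieAlgebra.Orthogonal

noncomputable section

namespace GenRigidBody

/-- The Lie algebra `𝔰𝔬(n)` of antisymmetric real `n × n` matrices. -/
abbrev SoAlg (n : ℕ) : Type := so (Fin n) ℝ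

/-- The rotation group `SO(n)`. -/
abbrev SOGroup (n : ℕ) : Type := Matrix.specialOrthogonalGroup (Fin n) ℝ

/-- `e i j` is the matrix with `-1` in position `(i, j)`, `1` in position `(j, i)`, and zeros
elsewhere. -/
def e {n : ℕ} (i j : Fin n) : SoAlg n :=
  ⟨Matrix.single j i 1 - Matrix.single i j 1, by
    rw [mem_so]; simp [Matrix.transpose_sub]⟩

/-- The bi-invariant inner product `⟨u, v⟩ = ½ Tr(u vᵀ)` on `𝔰𝔬(n)`. -/
def biForm (n : ℕ) : LinearMap.BilinForm ℝ (SoAlg n) :=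
  LinearMap.mk₂ ℝ
    (fun u v => (1 / 2 : ℝ) *
      Matrix.trace ((u : Matrix (Fin n) (Fin n) ℝ) * (v : Matrix (Fin n) (Fin n) ℝ)ᵀ))
    (by intro a b c; simp [Matrix.add_mul, mul_add])
    (by intro r a b; simp; ring)
    (by intro a b c; simp [mul_add])
    (by intro r a b; simp; ring)

/-- A generalized rigid body metric on `SO(n)`: an operator `Λ` on `𝔰𝔬(n)`, symmetric with respect
to the bi-invariant inner product, with all `e i j` (`i < j`) as eigenvectors, such that
`g(u, v) = ⟨u, Λ v⟩` is positive definite, so that `g` generates a left-invariant Riemannian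
metric. -/
structure RigidBodyMetric (n : ℕ) where
  op : SoAlg n →ₗ[ℝ] SoAlg n
  symm : ∀ u v, biForm n (op u) v = biForm n u (op v)
  eigen : ∀ i j : Fin n, i < j → ∃ c : ℝ, op (e i j) = c • e i j
  pos : ∀ u, u ≠ 0 → 0 < biForm n u (op u)

namespace RigidBodyMetric

variable {n : ℕ} (M : RigidBodyMetric n)

/-- The inner product `g(u, v) = ⟨u, Λ v⟩` on `𝔰𝔬(n)`. -/
def g : LinearMap.BilinForm ℝ (SoAlg n) :=
  (biForm n).compl₂ M.op

theorem g_nondegenerate : M.g.Nondegenerate := by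
  refine ⟨fun u hu => ?_, fun u hu => ?_⟩
  · by_contra h
    exact (M.pos u h).ne' (hu u)
  · by_contra h
    exact (M.pos u h).ne' (hu u)

/-- `ad⋆_u v`, as a bilinear map of `u` and `v`; it is characterised by
`g(ad⋆_u v, w) = g(v, [u, w])` for all `w`, see `g_adStar`. -/
def adStar : SoAlg n →ₗ[ℝ] SoAlg n →ₗ[ℝ] SoAlg n :=
  LinearMap.mk₂ ℝ
    (fun u v => (M.g.toDual M.g_nondegenerate).symm
      ((M.g v).comp (LieAlgebra.ad ℝ (SoAlg n) u : SoAlg n →ₗ[ℝ] SoAlg n)))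
    (by intro a b c; simp [LinearMap.comp_add])
    (by intro r a b; simp [LinearMap.comp_smul])
    (by intro a b c; simp [LinearMap.add_comp])
    (by intro r a b; simp [LinearMap.smul_comp])

theorem g_adStar (u v w : SoAlg n) : M.g (M.adStar u v) w = M.g v ⁅u, w⁆ := by
  simp [adStar]

/-- `u₀` is a steady solution of the Euler-Arnold equation `u' = ad⋆_u u`. -/
def IsSteady (u₀ : SoAlg n) : Prop := M.adStar u₀ u₀ = 0

/-- `γ` is the geodesic of the left-invariant metric generated by `g` with `γ(0) = id` and
`γ'(0) = u₀`: it solves `γ' = γ u`, `u' = ad⋆_u u` with `γ(0) = id`, `u(0) = u₀`. -/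
def IsGeodesicFrom (γ : ℝ → SOGroup n) (u₀ : SoAlg n) : Prop :=
  ∃ u : ℝ → SoAlg n,
    γ 0 = 1 ∧ u 0 = u₀ ∧
    (∀ t, HasDerivAt (fun s => (γ s : Matrix (Fin n) (Fin n) ℝ))
      ((γ t : Matrix (Fin n) (Fin n) ℝ) * (u t : Matrix (Fin n) (Fin n) ℝ)) t) ∧
    ∀ t, HasDerivAt (fun s => (u s : Matrix (Fin n) (Fin n) ℝ))
      (M.adStar (u t) (u t) : Matrix (Fin n) (Fin n) ℝ) t

open Classical in
/-- The Riemannian exponential map at the identity, `u₀ ↦ γ(1)` for the geodesic `γ` with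
`γ(0) = id` and `γ'(0) = u₀`. -/
def riemExp (u₀ : SoAlg n) : SOGroup n :=
  if h : ∃ γ, M.IsGeodesicFrom γ u₀ then h.choose 1 else 1

/-- The point at time `τ` of the geodesic from the identity with initial velocity `u₀` is conjugate
to the identity: the derivative `D exp(τ u₀)` of the Riemannian exponential map exists and is
singular. As `SO(n)` is an embedded submanifold of the space of matrices, with the same dimension as
`𝔰𝔬(n)`, the derivative into the tangent space of `SO(n)` is singular exactly when the derivative
into the space of matrices is not injective. -/
def IsConjugateTime (u₀ : SoAlg n) (τ : ℝ) : Prop :=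
  ∃ D : SoAlg n →L[ℝ] Matrix (Fin n) (Fin n) ℝ,
    HasFDerivAt (fun u => (M.riemExp u : Matrix (Fin n) (Fin n) ℝ)) D (τ • u₀) ∧
    ¬ Function.Injective D

/-- The Levi-Civita connection of the left-invariant metric on left-invariant vector fields:
`∇_u v = ½ ([u, v] - ad⋆_u v - ad⋆_v u)`, from the Koszul formula. -/
def nabla : SoAlg n →ₗ[ℝ] SoAlg n →ₗ[ℝ] SoAlg n :=
  (1 / 2 : ℝ) • ((LieAlgebra.ad ℝ (SoAlg n) : SoAlg n →ₗ[ℝ] SoAlg n →ₗ[ℝ] SoAlg n)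
    - M.adStar - M.adStar.flip)

/-- The map `u ↦ R(u, v) w = ∇_u ∇_v w - ∇_v ∇_u w - ∇_[u,v] w`. -/
def curv (v w : SoAlg n) : SoAlg n →ₗ[ℝ] SoAlg n :=
  M.nabla.flip (M.nabla v w) - (M.nabla v).comp (M.nabla.flip w)
    - (M.nabla.flip w).comp
        ((LieAlgebra.ad ℝ (SoAlg n) : SoAlg n →ₗ[ℝ] SoAlg n →ₗ[ℝ] SoAlg n).flip v)

/-- The Ricci curvature `Ric(v, w)`, the trace of `u ↦ R(u, v) w`, at the identity. -/
def ricci (v w : SoAlg n) : ℝ := LinearMap.trace ℝ (SoAlg n) (M.curv v w)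

end RigidBodyMetric

end GenRigidBody

end

/-!
Three ideas carry the proof.

*Completeness.* Extended to all matrices, the Euler–Arnold system `u' = ad⋆_u u`, `γ' = γ u` has a
quadratic vector field. On skew `u` it conserves `g(u, u)` and `γ γᵀ`, and so does any product of
this vector field with a scalar function. A cut-off thus makes the field bounded and Lipschitz
without changing the solutions of interest, and Picard–Lindelöf applies on every time interval
(`RigidBodyMetric.exists_apriori_bound`, `RigidBodyMetric.existsUnique_isGeodesicFrom`). The
determinant of `γ` stays `1` by connectedness of the time line.

*The derivative of the exponential map.* At a steady velocity `u₀` the geodesic is `t ↦ exp(t u₀)`.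
Left translation by its inverse turns `(u₀, 1)` into an equilibrium of a quadratic vector field, for
which the linearization approximates the time-one map to second order by Grönwall's inequality
(`exists_norm_sub_linearFlow_le`). Hence the derivative exists and is given by the
constant-coefficient system `z' = ad⋆_z u₀ + ad⋆_{u₀} z`, `w' = z - [u₀, w]`
(`RigidBodyMetric.exists_hasFDerivAt_riemExp`). A nonzero solution with `w = 0` at both ends makes
the derivative singular.

*Conjugate points.* For `u₀ = e i j` and a third index `k`, the system leaves the plane of `e i k`
and `e j k` invariant. If `c`, `c₁`, `c₂` are the eigenvalues of `e i j`, `e i k`, `e j k`, it reads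
`a' = p b`, `b' = -q a`, `w₁' = a + w₂`, `w₂' = b - w₁` with `p = (c₂ - c) / c₁` and
`q = (c₁ - c) / c₂`. Time reversal about the midpoint of the interval is a symmetry. For a symmetric
solution on `[-T, T]`, vanishing at the ends is the one scalar equation
`(1 + p) q S(T) cos T = (1 + q) C(T) sin T`, where `C`, `S` are the cosine and sine (trigonometric,
affine or hyperbolic) of `S'' = -p q S`. A change of sign gives a solution `T > 0`, whatever the
signs of `p` and `q`, except at the resonance `p q = 1`. There `c = c₁ + c₂` and `p = q = -1`, and the
field `sin t • e i k` vanishes at `0` and at `π` (`exists_isPlanarJacobi`).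

The Ricci curvature of a diagonal metric is computed on the basis vectors
(`RigidBodyMetric.exists_ricci_neg`).
-/

noncomputable section

namespace GenRigidBody

/-! ### Ordinary differential equations -/

section ODE

open Set Metric
open scoped NNReal

variable {V : Type*} [NormedAddCommGroup V] [NormedSpace ℝ V]

/-- A bounded, globally Lipschitz vector field is complete. -/
theorem exists_global_solution_of_lipschitz [CompleteSpace V] {G : V → V} {K : ℝ≥0}
    (hK : LipschitzWith K G) {L : ℝ} (hL : ∀ x, ‖G x‖ ≤ L) (x₀ : V) :
    ∃ x : ℝ → V, x 0 = x₀ ∧ ∀ t, HasDerivAt x (G (x t)) t := by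
  have hL0 : 0 ≤ L := (norm_nonneg _).trans (hL x₀)
  lift L to ℝ≥0 using hL0
  have key : ∀ a : ℝ, 0 < a → ∃ x : ℝ → V, x 0 = x₀ ∧
      ∀ t ∈ Ioo (-a) a, HasDerivAt x (G (x t)) t := by
    intro a ha
    have h0 : (0 : ℝ) ∈ Icc (-a) a := ⟨by linarith, ha.le⟩
    have hP : IsPicardLindelof (fun _ => G) (⟨0, h0⟩ : Icc (-a) a) x₀ (L * a.toNNReal) 0 L K :=
      IsPicardLindelof.of_time_independent (fun x _ => hL x) hK.lipschitzOnWith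
        (by simp [ha.le])
    obtain ⟨x, hx0, hx⟩ := hP.exists_eq_forall_mem_Icc_hasDerivWithinAt₀
    exact ⟨x, hx0, fun t ht => (hx t (Ioo_subset_Icc_self ht)).hasDerivAt
      (Icc_mem_nhds ht.1 ht.2)⟩
  choose! x hx0 hx using key
  have huniq : ∀ a b : ℝ, 0 < a → a ≤ b → EqOn (x a) (x b) (Ioo (-a) a) := by
    intro a b ha hab
    refine ODE_solution_unique_of_mem_Ioo (v := fun _ => G) (s := fun _ => univ) (K := K) (t₀ := 0)
      (fun _ _ => hK.lipschitzOnWith) ⟨by linarith, ha⟩ (fun t ht => ⟨hx a ha t ht, trivial⟩)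
      (fun t ht => ⟨hx b (ha.trans_le hab) t ⟨by linarith [ht.1], by linarith [ht.2]⟩, trivial⟩) ?_
    rw [hx0 a ha, hx0 b (ha.trans_le hab)]
  refine ⟨fun t => x (|t| + 1) t, hx0 _ (by positivity), fun t => ?_⟩
  have hpos : 0 < |t| + 2 := by positivity
  have ht : t ∈ Ioo (-(|t| + 1)) (|t| + 1) := abs_lt.1 (lt_add_one _)
  have hd := hx (|t| + 2) hpos t (abs_lt.1 (by linarith))
  have heq : ∀ s ∈ Ioo (-(|t| + 1)) (|t| + 1), x (|s| + 1) s = x (|t| + 2) s := fun s hs =>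
    huniq _ _ (by positivity) (by linarith [abs_lt.2 hs]) (abs_lt.1 (lt_add_one _))
  change HasDerivAt _ (G (x (|t| + 1) t)) t
  rw [heq t ht]
  exact hd.congr_of_eventuallyEq (Filter.eventually_of_mem (Ioo_mem_nhds ht.1 ht.2) heq)

/-- A smooth function equal to `1` on the ball of radius `R` turns a `C¹` vector field into one that
is bounded and globally Lipschitz. -/
theorem exists_cutoff [FiniteDimensional ℝ V] {F : V → V} (hF : ContDiff ℝ 1 F) {R : ℝ}
    (hR : 0 < R) :
    ∃ χ : V → ℝ, (∀ x, ‖x‖ ≤ R → χ x = 1) ∧ (∃ K : ℝ≥0, LipschitzWith K fun x => χ x • F x) ∧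
      ∃ L : ℝ, ∀ x, ‖χ x • F x‖ ≤ L := by
  let χ : ContDiffBump (0 : V) := ⟨R, R + 1, hR, by linarith⟩
  have hc : HasCompactSupport fun x => χ x • F x := χ.hasCompactSupport.smul_right
  have hd : ContDiff ℝ 1 fun x => χ x • F x := χ.contDiff.smul hF
  exact ⟨χ, fun x hx => χ.one_of_mem_closedBall (by simpa using hx),
    hd.lipschitzWith_of_hasCompactSupport hc one_ne_zero,
    hc.exists_bound_of_continuous hd.continuous⟩

/-- A `C¹` vector field has a global solution through `x₀` as soon as there is an a priori bound for
the solutions through `x₀` of all its rescalings. -/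
theorem exists_global_solution_of_bounded [FiniteDimensional ℝ V] {F : V → V}
    (hF : ContDiff ℝ 1 F) {R : ℝ} (hR : 0 < R) (x₀ : V)
    (hbound : ∀ (c : ℝ → ℝ) (x : ℝ → V), x 0 = x₀ → (∀ t, HasDerivAt x (c t • F (x t)) t) →
      ∀ t, ‖x t‖ ≤ R) :
    ∃ x : ℝ → V, x 0 = x₀ ∧ ∀ t, HasDerivAt x (F (x t)) t := by
  have := FiniteDimensional.complete ℝ V
  obtain ⟨χ, hχ, ⟨K, hK⟩, L, hL⟩ := exists_cutoff hF hR
  obtain ⟨x, hx0, hx⟩ := exists_global_solution_of_lipschitz hK hL x₀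
  refine ⟨x, hx0, fun t => ?_⟩
  have := hx t
  rwa [hχ _ (hbound (fun t => χ (x t)) x hx0 hx t), one_smul] at this

theorem eq_of_bounded_solutions [FiniteDimensional ℝ V] {F : V → V} (hF : ContDiff ℝ 1 F) {R : ℝ}
    (hR : 0 < R) {x y : ℝ → V} (hx : ∀ t, HasDerivAt x (F (x t)) t)
    (hy : ∀ t, HasDerivAt y (F (y t)) t) (hxR : ∀ t, ‖x t‖ ≤ R) (hyR : ∀ t, ‖y t‖ ≤ R)
    (h0 : x 0 = y 0) : x = y := by
  obtain ⟨χ, hχ, ⟨K, hK⟩, -⟩ := exists_cutoff hF hR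
  refine ODE_solution_unique_univ (v := fun _ x => χ x • F x) (s := fun _ => univ) (K := K)
    (t₀ := 0) (fun _ => hK.lipschitzOnWith) (fun t => ⟨?_, trivial⟩) (fun t => ⟨?_, trivial⟩) h0
  · simpa [hχ _ (hxR t)] using hx t
  · simpa [hχ _ (hyR t)] using hy t

/-- The time-one flow `exp A` of the linear vector field `A`. -/
def linearFlow (A : V →L[ℝ] V) : V →L[ℝ] V := NormedSpace.exp A

theorem gronwallBound_zero_left (K ε x : ℝ) :
    gronwallBound 0 K ε x = ε * gronwallBound 0 K 1 x := by
  unfold gronwallBound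
  split_ifs <;> ring

/-- The linearization at the equilibrium `0` approximates the time-one map of a quadratic vector
field to second order, along solutions in a fixed ball. -/
theorem exists_norm_sub_linearFlow_le [CompleteSpace V] (A : V →L[ℝ] V) (Q : V →L[ℝ] V →L[ℝ] V)
    (R : ℝ) :
    ∃ C : ℝ, ∀ y : ℝ → V, (∀ t, HasDerivAt y (A (y t) + Q (y t) (y t)) t) →
      (∀ t ∈ Icc (0 : ℝ) 1, ‖y t‖ ≤ R) →
      ‖y 1 - linearFlow A (y 0)‖ ≤ C * ‖y 0‖ ^ 2 := by
  set K : ℝ := ‖A‖ + ‖Q‖ * R with hKdef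
  refine ⟨‖Q‖ * Real.exp K ^ 2 * gronwallBound 0 ‖A‖ 1 1, fun y hy hyR => ?_⟩
  have hR : 0 ≤ R := (norm_nonneg _).trans (hyR 0 ⟨le_rfl, zero_le_one⟩)
  have hK : 0 ≤ K := by positivity
  have hQ : ∀ t, ‖Q (y t) (y t)‖ ≤ ‖Q‖ * ‖y t‖ * ‖y t‖ := fun t => Q.le_opNorm₂ _ _
  have hcont : Continuous y := continuous_iff_continuousAt.2 fun t => (hy t).continuousAt
  have hy1 : ∀ t ∈ Icc (0 : ℝ) 1, ‖y t‖ ≤ ‖y 0‖ * Real.exp K := by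
    intro t ht
    have h := norm_le_gronwallBound_of_norm_deriv_right_le (δ := ‖y 0‖) (K := K) (ε := 0)
      (a := 0) (b := 1) hcont.continuousOn
      (fun t _ => (hy t).hasDerivWithinAt) le_rfl (fun t _ => ?_) t ht
    · rw [gronwallBound_ε0] at h
      refine h.trans (mul_le_mul_of_nonneg_left (Real.exp_le_exp.2 ?_) (norm_nonneg _))
      simpa using mul_le_mul_of_nonneg_left ht.2 hK
    · calc ‖A (y t) + Q (y t) (y t)‖ ≤ ‖A‖ * ‖y t‖ + ‖Q‖ * ‖y t‖ * ‖y t‖ :=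
            (norm_add_le _ _).trans (add_le_add (A.le_opNorm _) (hQ t))
        _ ≤ ‖A‖ * ‖y t‖ + ‖Q‖ * R * ‖y t‖ := by gcongr; exact hyR t (Ico_subset_Icc_self ‹_›)
        _ = K * ‖y t‖ + 0 := by rw [hKdef]; ring
  have hexp : ∀ t : ℝ, HasDerivAt (fun s : ℝ => NormedSpace.exp (s • A) (y 0))
      (A (NormedSpace.exp (t • A) (y 0))) t := fun t =>
    ((ContinuousLinearMap.apply ℝ V (y 0)).hasFDerivAt.comp_hasDerivAt t
      (hasDerivAt_exp_smul_const' A t) :)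
  have hv : ∀ t, HasDerivAt (fun s => y s - NormedSpace.exp (s • A) (y 0))
      (A (y t) + Q (y t) (y t) - A (NormedSpace.exp (t • A) (y 0))) t := fun t =>
    (hy t).sub (hexp t)
  have h := norm_le_gronwallBound_of_norm_deriv_right_le (δ := 0) (K := ‖A‖)
    (ε := ‖Q‖ * Real.exp K ^ 2 * ‖y 0‖ ^ 2) (a := 0) (b := 1)
    (continuous_iff_continuousAt.2 fun t => (hv t).continuousAt).continuousOn
    (fun t _ => (hv t).hasDerivWithinAt) (by simp) (fun t ht => ?_) 1 ⟨zero_le_one, le_rfl⟩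
  · rw [gronwallBound_zero_left] at h
    simp only [one_smul, sub_zero] at h
    rw [linearFlow]
    linarith
  · have e1 : A (y t) + Q (y t) (y t) - A (NormedSpace.exp (t • A) (y 0)) =
        A (y t - NormedSpace.exp (t • A) (y 0)) + Q (y t) (y t) := by rw [map_sub]; abel
    rw [e1]
    have h1 := hy1 t (Ico_subset_Icc_self ht)
    calc _ ≤ ‖A‖ * ‖y t - NormedSpace.exp (t • A) (y 0)‖ + ‖Q‖ * ‖y t‖ * ‖y t‖ :=
          (norm_add_le _ _).trans (add_le_add (A.le_opNorm _) (hQ t))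
      _ ≤ ‖A‖ * ‖y t - NormedSpace.exp (t • A) (y 0)‖ +
          ‖Q‖ * (‖y 0‖ * Real.exp K) * (‖y 0‖ * Real.exp K) := by gcongr
      _ = _ := by ring

theorem eq_linearFlow_apply_of_hasDerivAt [CompleteSpace V] (A : V →L[ℝ] V) {y : ℝ → V}
    (hy : ∀ t, HasDerivAt y (A (y t)) t) : y 1 = linearFlow A (y 0) := by
  have hexp : ∀ t : ℝ, HasDerivAt (fun s : ℝ => NormedSpace.exp (s • A) (y 0))
      (A (NormedSpace.exp (t • A) (y 0))) t := fun t =>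
    ((ContinuousLinearMap.apply ℝ V (y 0)).hasFDerivAt.comp_hasDerivAt t
      (hasDerivAt_exp_smul_const' A t) :)
  have := ODE_solution_unique_univ (v := fun _ => A) (s := fun _ => univ) (K := ‖A‖₊) (t₀ := 0)
    (fun _ => A.lipschitz.lipschitzOnWith) (fun t => ⟨hy t, trivial⟩)
    (fun t => ⟨hexp t, trivial⟩) (by simp)
  simpa [linearFlow] using congrFun this 1

end ODE

/-! ### The Euler–Arnold system in a normed algebra -/

section EulerArnold

open Set

variable {E : Type*} [NormedRing E] [NormedAlgebra ℝ E]

/-- The vector field `(u, γ) ↦ (N(u, u), γ u)` of the Euler–Arnold system. -/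
def eulerArnoldField (N : E →L[ℝ] E →L[ℝ] E) (x : E × E) : E × E := (N x.1 x.1, x.2 * x.1)

theorem contDiff_eulerArnoldField (N : E →L[ℝ] E →L[ℝ] E) :
    ContDiff ℝ 1 (eulerArnoldField N) := by
  unfold eulerArnoldField
  fun_prop

variable [FiniteDimensional ℝ E]

theorem exists_eulerArnold_solution (N : E →L[ℝ] E →L[ℝ] E) {R : ℝ} (hR : 0 < R) (u₀ : E)
    (hbound : ∀ (c : ℝ → ℝ) (u γ : ℝ → E), u 0 = u₀ → γ 0 = 1 →
      (∀ t, HasDerivAt u (c t • N (u t) (u t)) t) → (∀ t, HasDerivAt γ (c t • (γ t * u t)) t) →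
      ∀ t, ‖u t‖ ≤ R ∧ ‖γ t‖ ≤ R) :
    ∃ u γ : ℝ → E, u 0 = u₀ ∧ γ 0 = 1 ∧ (∀ t, HasDerivAt u (N (u t) (u t)) t) ∧
      ∀ t, HasDerivAt γ (γ t * u t) t := by
  obtain ⟨x, hx0, hx⟩ := exists_global_solution_of_bounded (contDiff_eulerArnoldField N) hR (u₀, 1)
    (fun c x hx0 hx t => by
      have h := hbound c (fun t => (x t).1) (fun t => (x t).2) (by simp [hx0]) (by simp [hx0])
        (fun t => (hx t).fst) (fun t => (hx t).snd) t
      exact max_le h.1 h.2)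
  exact ⟨fun t => (x t).1, fun t => (x t).2, by simp [hx0], by simp [hx0],
    fun t => (hx t).fst, fun t => (hx t).snd⟩

theorem eulerArnold_unique (N : E →L[ℝ] E →L[ℝ] E) {R : ℝ} (hR : 0 < R) {u γ v η : ℝ → E}
    (hu : ∀ t, HasDerivAt u (N (u t) (u t)) t) (hγ : ∀ t, HasDerivAt γ (γ t * u t) t)
    (hv : ∀ t, HasDerivAt v (N (v t) (v t)) t) (hη : ∀ t, HasDerivAt η (η t * v t) t)
    (huR : ∀ t, ‖u t‖ ≤ R) (hγR : ∀ t, ‖γ t‖ ≤ R) (hvR : ∀ t, ‖v t‖ ≤ R) (hηR : ∀ t, ‖η t‖ ≤ R)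
    (h0 : u 0 = v 0) (h1 : γ 0 = η 0) : γ = η := by
  have h := eq_of_bounded_solutions (x := fun t => (u t, γ t)) (y := fun t => (v t, η t))
    (contDiff_eulerArnoldField N) hR
    (fun t => (hu t).prodMk (hγ t)) (fun t => (hv t).prodMk (hη t))
    (fun t => max_le (huR t) (hγR t)) (fun t => max_le (hvR t) (hηR t)) (by simp [h0, h1])
  exact funext fun t => congrArg Prod.snd (congrFun h t)

/-- The linear part at `(u₀, 1)` of the Euler–Arnold system left-translated along `t ↦ exp(t u₀)`.
The second component is the equation `w' = z - [u₀, w]` of a Jacobi field `exp(t u₀) w`. -/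
def jacobiField (N : E →L[ℝ] E →L[ℝ] E) (u₀ : E) : E × E →L[ℝ] E × E :=
  ((N.flip u₀ + N u₀).comp (ContinuousLinearMap.fst ℝ E E)).prod
    (ContinuousLinearMap.fst ℝ E E -
      (ContinuousLinearMap.mul ℝ E u₀ - (ContinuousLinearMap.mul ℝ E).flip u₀).comp
        (ContinuousLinearMap.snd ℝ E E))

/-- The quadratic part of the left-translated Euler–Arnold system. -/
def jacobiQuadratic (N : E →L[ℝ] E →L[ℝ] E) : E × E →L[ℝ] E × E →L[ℝ] E × E :=
  LinearMap.toContinuousBilinearMap <| LinearMap.mk₂ ℝ (fun x y => (N x.1 y.1, x.2 * y.1))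
    (by intro a b c; simp [add_mul]) (by intro r a b; simp)
    (by intro a b c; simp [mul_add]) (by intro r a b; simp)

/-- The derivative at an equilibrium `u₀` of the map `u ↦ γ(1)`, where `γ' = γ u` and
`u' = N(u, u)`. -/
def expDeriv (N : E →L[ℝ] E →L[ℝ] E) (u₀ : E) : E →L[ℝ] E :=
  (ContinuousLinearMap.mul ℝ E (NormedSpace.exp u₀)).comp
    ((ContinuousLinearMap.snd ℝ E E).comp
      ((linearFlow (jacobiField N u₀)).comp
        (ContinuousLinearMap.inl ℝ E E)))

theorem expDeriv_apply_of_jacobi (N : E →L[ℝ] E →L[ℝ] E) (u₀ : E) {z w : ℝ → E}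
    (hz : ∀ t, HasDerivAt z (N (z t) u₀ + N u₀ (z t)) t)
    (hw : ∀ t, HasDerivAt w (z t - (u₀ * w t - w t * u₀)) t) (hw0 : w 0 = 0) :
    expDeriv N u₀ (z 0) = NormedSpace.exp u₀ * w 1 := by
  have := FiniteDimensional.complete ℝ E
  have h := eq_linearFlow_apply_of_hasDerivAt (jacobiField N u₀) (y := fun t => (z t, w t))
    (fun t => (hz t).prodMk (hw t))
  have h2 : w 1 = (linearFlow (jacobiField N u₀) (z 0, w 0)).2 := congrArg Prod.snd h
  rw [h2, hw0]
  rfl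

theorem exists_norm_sub_expDeriv_le (N : E →L[ℝ] E →L[ℝ] E) {u₀ : E} (hu₀ : N u₀ u₀ = 0) (R : ℝ) :
    ∃ C : ℝ, ∀ u γ : ℝ → E, γ 0 = 1 → (∀ t, HasDerivAt u (N (u t) (u t)) t) →
      (∀ t, HasDerivAt γ (γ t * u t) t) → (∀ t, ‖u t‖ ≤ R) → (∀ t, ‖γ t‖ ≤ R) →
      ‖γ 1 - NormedSpace.exp u₀ - expDeriv N u₀ (u 0 - u₀)‖ ≤ C * ‖u 0 - u₀‖ ^ 2 := by
  have := FiniteDimensional.complete ℝ E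
  have hg : ∀ t : ℝ, HasDerivAt (fun s : ℝ => NormedSpace.exp (s • (-u₀)))
      (-u₀ * NormedSpace.exp (t • (-u₀))) t := hasDerivAt_exp_smul_const' (-u₀)
  obtain ⟨B, hB⟩ := isCompact_Icc.exists_bound_of_continuousOn (s := Icc (0 : ℝ) 1)
    (continuous_iff_continuousAt.2 fun t => (hg t).continuousAt).continuousOn
  obtain ⟨C, hC⟩ := exists_norm_sub_linearFlow_le (jacobiField N u₀) (jacobiQuadratic N)
    (max (R + ‖u₀‖) (B * R + ‖(1 : E)‖))
  refine ⟨‖NormedSpace.exp u₀‖ * C, fun u γ hγ0 hu hγ huR hγR => ?_⟩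
  have hR : 0 ≤ R := (norm_nonneg _).trans (huR 0)
  -- The left-translated curve, which is constantly `1` for the steady solution.
  set ζ : ℝ → E := fun t => NormedSpace.exp (t • (-u₀)) * γ t with hζ
  have hζ' : ∀ t, HasDerivAt ζ (-u₀ * ζ t + ζ t * u t) t := fun t => by
    have h := (hg t).mul (hγ t)
    refine h.congr_deriv ?_
    simp only [hζ, mul_assoc]
  have h := hC (fun t => (u t - u₀, ζ t - 1)) (fun t => ?_) (fun t ht => max_le_max ?_ ?_)
  · have hζ0 : ζ 0 = 1 := by simp [hζ, hγ0]
    have hγ1 : γ 1 = NormedSpace.exp u₀ * ζ 1 := by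
      let _ := NormedAlgebra.restrictScalars ℚ ℝ E
      simp only [hζ, one_smul, ← mul_assoc]
      rw [← NormedSpace.exp_add_of_commute (Commute.neg_right rfl), add_neg_cancel,
        NormedSpace.exp_zero, one_mul]
    simp only [hζ0, sub_self] at h
    have hnorm : ‖((u 0 - u₀, 0) : E × E)‖ = ‖u 0 - u₀‖ := by simp [Prod.norm_def]
    rw [hnorm] at h
    have e : γ 1 - NormedSpace.exp u₀ - expDeriv N u₀ (u 0 - u₀) = NormedSpace.exp u₀ *
        ((u 1 - u₀, ζ 1 - 1) - linearFlow (jacobiField N u₀) (u 0 - u₀, 0)).2 := by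
      rw [hγ1, Prod.snd_sub, mul_sub, mul_sub, mul_one]
      rfl
    rw [e, mul_assoc]
    exact (norm_mul_le _ _).trans (mul_le_mul_of_nonneg_left ((norm_snd_le _).trans h)
      (norm_nonneg _))
  · refine ((hu t).sub_const u₀).prodMk ((hζ' t).sub_const 1) |>.congr_deriv ?_
    ext
    · simp [jacobiField, jacobiQuadratic, hu₀]
    · simp [jacobiField, jacobiQuadratic]
      noncomm_ring
  · exact (norm_sub_le _ _).trans (add_le_add (huR t) le_rfl)
  · refine (norm_sub_le _ _).trans (add_le_add ((norm_mul_le _ _).trans ?_) le_rfl)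
    exact mul_le_mul (hB t ht) (hγR t) (norm_nonneg _) ((norm_nonneg _).trans (hB t ht))

end EulerArnold

/-! ### Bilinear maps in finite dimension -/

section Bilinear

variable {V W : Type*} [NormedAddCommGroup V] [NormedSpace ℝ V] [FiniteDimensional ℝ V]
  [NormedAddCommGroup W] [NormedSpace ℝ W]

theorem hasDerivAt_linear (f : V →ₗ[ℝ] W) {u : ℝ → V} {u' : V} {t : ℝ} (hu : HasDerivAt u u' t) :
    HasDerivAt (fun s => f (u s)) (f u') t :=
  (LinearMap.toContinuousLinearMap f).hasFDerivAt.comp_hasDerivAt t hu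

theorem hasDerivAt_bilinear (B : V →ₗ[ℝ] V →ₗ[ℝ] W) {u v : ℝ → V} {u' v' : V} {t : ℝ}
    (hu : HasDerivAt u u' t) (hv : HasDerivAt v v' t) :
    HasDerivAt (fun s => B (u s) (v s)) (B (u t) v' + B u' (v t)) t :=
  ((LinearMap.toContinuousBilinearMap B).hasFDerivAt_of_bilinear
    hu.hasFDerivAt hv.hasFDerivAt).hasDerivAt.congr_deriv (by simp)

theorem exists_bilinear_self_le (B : V →ₗ[ℝ] V →ₗ[ℝ] ℝ) :
    ∃ C : ℝ, 0 ≤ C ∧ ∀ u, B u u ≤ C * ‖u‖ ^ 2 := by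
  refine ⟨‖LinearMap.toContinuousBilinearMap B‖, norm_nonneg (LinearMap.toContinuousBilinearMap B),
    fun u => (le_abs_self _).trans ?_⟩
  have := (LinearMap.toContinuousBilinearMap B).le_opNorm₂ u u
  rw [mul_assoc, ← sq] at this
  exact this

theorem exists_norm_sq_le_of_pos (B : V →ₗ[ℝ] V →ₗ[ℝ] ℝ) (hB : ∀ u, u ≠ 0 → 0 < B u u) :
    ∃ C : ℝ, 0 ≤ C ∧ ∀ u, ‖u‖ ^ 2 ≤ C * B u u := by
  have hne : ∀ u ∈ Metric.sphere (0 : V) 1, u ≠ 0 := fun u hu => ne_zero_of_mem_unit_sphere ⟨u, hu⟩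
  have hcont : Continuous fun u => B u u :=
    ((LinearMap.toContinuousBilinearMap B).continuous.clm_apply continuous_id :)
  obtain ⟨C, hC⟩ := (isCompact_sphere (0 : V) 1).exists_bound_of_continuousOn
    (f := fun u => (B u u)⁻¹) (hcont.continuousOn.inv₀ fun u hu => (hB u (hne u hu)).ne')
  refine ⟨max C 0, le_max_right _ _, fun u => ?_⟩
  rcases eq_or_ne u 0 with rfl | hu
  · simp
  have hn : 0 < ‖u‖ := norm_pos_iff.2 hu
  have hv : (‖u‖⁻¹ • u) ∈ Metric.sphere (0 : V) 1 := by simp [norm_smul, hn.ne']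
  have h1 := hC _ hv
  have h2 := hB _ (hne _ hv)
  rw [Real.norm_of_nonneg (inv_nonneg.2 h2.le), inv_le_iff_one_le_mul₀ h2] at h1
  simp only [map_smul, LinearMap.smul_apply, smul_eq_mul] at h1
  have h3 : ‖u‖ ^ 2 ≤ C * B u u := by
    calc ‖u‖ ^ 2 = ‖u‖ ^ 2 * 1 := (mul_one _).symm
      _ ≤ ‖u‖ ^ 2 * (C * (‖u‖⁻¹ * (‖u‖⁻¹ * B u u))) := by gcongr
      _ = C * B u u := by field_simp
  exact h3.trans (mul_le_mul_of_nonneg_right (le_max_left _ _) (hB u hu).le)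

theorem eq_of_hasDerivAt_zero {f : ℝ → W} (hf : ∀ t, HasDerivAt f 0 t) (t : ℝ) : f t = f 0 :=
  is_const_of_deriv_eq_zero (fun t => (hf t).differentiableAt) (fun t => (hf t).deriv) t 0

omit [FiniteDimensional ℝ V] in
theorem hasFDerivAt_of_norm_le_sq {f : V → W} {D : V →L[ℝ] W} {x₀ : V} {C : ℝ}
    (h : ∀ x, ‖x - x₀‖ ≤ 1 → ‖f x - f x₀ - D (x - x₀)‖ ≤ C * ‖x - x₀‖ ^ 2) :
    HasFDerivAt f D x₀ := by
  rw [hasFDerivAt_iff_isLittleO]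
  refine Asymptotics.IsBigO.trans_isLittleO (g := fun x => ‖x - x₀‖ ^ 2) ?_ ?_
  · refine Asymptotics.IsBigO.of_bound C ?_
    filter_upwards [Metric.closedBall_mem_nhds x₀ one_pos] with x hx
    simpa using h x (by simpa [dist_eq_norm] using hx)
  · have h1 : Filter.Tendsto (fun x => x - x₀) (nhds x₀) (nhds 0) := by
      rw [← sub_self x₀]
      exact (continuous_id.sub continuous_const).tendsto x₀
    exact (Asymptotics.isLittleO_norm_pow_id one_lt_two).comp_tendsto h1

end Bilinear

/-! ### Geodesics on `SO(n)` -/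

section Geodesic

-- Any submultiplicative norm on the matrices serves; it induces their usual topology.
attribute [local instance] Matrix.linftyOpNormedRing Matrix.linftyOpNormedAlgebra

variable {n : ℕ}

theorem trace_mul_transpose_self_pos {a : Matrix (Fin n) (Fin n) ℝ} (ha : a ≠ 0) :
    0 < trace (a * aᵀ) := by
  have h0 : trace (a * aᵀ) = ∑ i, ∑ j, a i j ^ 2 := by
    simp [trace, mul_apply, sq]
  rw [h0]
  refine lt_of_le_of_ne (Finset.sum_nonneg fun i _ => Finset.sum_nonneg fun j _ => sq_nonneg _)
    fun h => ha ?_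
  ext i j
  have h1 := (Finset.sum_eq_zero_iff_of_nonneg
    fun i _ => Finset.sum_nonneg fun j _ => sq_nonneg (a i j)).1 h.symm i (Finset.mem_univ i)
  have h2 := (Finset.sum_eq_zero_iff_of_nonneg fun j _ => sq_nonneg (a i j)).1 h1 j
    (Finset.mem_univ j)
  simpa using h2

theorem biForm_self_pos {u : SoAlg n} (hu : u ≠ 0) : 0 < biForm n u u :=
  mul_pos one_half_pos (trace_mul_transpose_self_pos fun h => hu (Subtype.ext h))

/-- The projection `m ↦ ½ (m - mᵀ)` of the matrices onto `𝔰𝔬(n)`. -/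
def skewPart (n : ℕ) : Matrix (Fin n) (Fin n) ℝ →ₗ[ℝ] SoAlg n where
  toFun m := ⟨(1 / 2 : ℝ) • (m - mᵀ), by
    rw [mem_so, transpose_smul, transpose_sub, transpose_transpose, ← smul_neg, neg_sub]⟩
  map_add' a b := by
    ext1
    change (1 / 2 : ℝ) • (a + b - (a + b)ᵀ) = (1 / 2 : ℝ) • (a - aᵀ) + (1 / 2 : ℝ) • (b - bᵀ)
    rw [transpose_add]
    module
  map_smul' r a := by
    ext1
    change (1 / 2 : ℝ) • (r • a - (r • a)ᵀ) = r • (1 / 2 : ℝ) • (a - aᵀ)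
    rw [transpose_smul]
    module

theorem skewPart_coe (u : SoAlg n) : skewPart n (u : Matrix (Fin n) (Fin n) ℝ) = u := by
  ext1
  have h := (mem_so _ _ _).1 u.2
  simp only [skewPart, LinearMap.coe_mk, AddHom.coe_mk, h]
  module

/-- The inclusion of `𝔰𝔬(n)` into the space of matrices. -/
def soIncl (n : ℕ) : SoAlg n →ₗ[ℝ] Matrix (Fin n) (Fin n) ℝ where
  toFun u := u
  map_add' _ _ := rfl
  map_smul' _ _ := rfl

namespace RigidBodyMetric

variable (M : RigidBodyMetric n)

/-- The bilinear map `ad⋆`, extended from `𝔰𝔬(n)` to all matrices by the projection `skewPart`. -/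
def adStarMat : Matrix (Fin n) (Fin n) ℝ →ₗ[ℝ] Matrix (Fin n) (Fin n) ℝ →ₗ[ℝ]
    Matrix (Fin n) (Fin n) ℝ :=
  (M.adStar.compl₁₂ (skewPart n) (skewPart n)).compr₂ (soIncl n)

theorem adStarMat_coe (u v : SoAlg n) :
    M.adStarMat u v = (M.adStar u v : Matrix (Fin n) (Fin n) ℝ) := by
  simp [adStarMat, skewPart_coe, soIncl]

theorem g_symm (u v : SoAlg n) : M.g u v = M.g v u := by
  have h : ∀ a b : SoAlg n, biForm n a b = biForm n b a := fun a b => by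
    simp only [biForm, LinearMap.mk₂_apply]
    rw [← trace_transpose, transpose_mul, transpose_transpose]
  change biForm n u (M.op v) = biForm n v (M.op u)
  rw [← M.symm, h]

theorem g_adStar_self (u : SoAlg n) : M.g u (M.adStar u u) = 0 := by
  rw [g_symm, g_adStar, lie_self, map_zero]

/-- The constant `C` controls every solution `(u, γ)` of every rescaling of the Euler–Arnold system,
posed in the space of matrices, that starts on `𝔰𝔬(n) × {1}`. Such a solution stays in the skew
matrices and in the orthogonal group. The time-dependent factor `c` allows for cut-off vector
fields. -/
def IsAprioriBound (C : ℝ) : Prop :=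
  ∀ (c : ℝ → ℝ) (u γ : ℝ → Matrix (Fin n) (Fin n) ℝ) (u₀ : SoAlg n), u 0 = u₀ → γ 0 = 1 →
    (∀ t, HasDerivAt u (c t • M.adStarMat (u t) (u t)) t) →
    (∀ t, HasDerivAt γ (c t • (γ t * u t)) t) →
    ∀ t, u t = skewPart n (u t) ∧ γ t * (γ t)ᵀ = 1 ∧ ‖u t‖ ≤ C * ‖u 0‖ ∧ ‖γ t‖ ≤ C

/-- Conservation of the energy `g(u, u)` and of `γ γᵀ` bounds the solutions of all rescalings of the
Euler–Arnold system. -/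
theorem exists_apriori_bound : ∃ C : ℝ, 0 < C ∧ M.IsAprioriBound C := by
  let T : Matrix (Fin n) (Fin n) ℝ →ₗ[ℝ] Matrix (Fin n) (Fin n) ℝ →ₗ[ℝ]
      Matrix (Fin n) (Fin n) ℝ :=
    (LinearMap.mul ℝ _).compl₂ (transposeLinearEquiv _ _ ℝ ℝ).toLinearMap
  have hT : ∀ a b, T a b = a * bᵀ := fun a b => rfl
  let B : Matrix (Fin n) (Fin n) ℝ →ₗ[ℝ] Matrix (Fin n) (Fin n) ℝ →ₗ[ℝ] ℝ :=
    T.compr₂ (traceLinearMap _ ℝ ℝ)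
  have hBpos : ∀ a, a ≠ 0 → 0 < B a a := fun a ha => trace_mul_transpose_self_pos ha
  obtain ⟨C₁, hC₁, h₁⟩ := exists_norm_sq_le_of_pos (V := Matrix (Fin n) (Fin n) ℝ) B hBpos
  let H : Matrix (Fin n) (Fin n) ℝ →ₗ[ℝ] Matrix (Fin n) (Fin n) ℝ →ₗ[ℝ] ℝ :=
    M.g.compl₁₂ (skewPart n) (skewPart n)
  obtain ⟨C₂, hC₂, h₂⟩ := exists_norm_sq_le_of_pos (V := SoAlg n) M.g M.pos
  obtain ⟨C₃, hC₃, h₃⟩ := exists_bilinear_self_le (V := Matrix (Fin n) (Fin n) ℝ) H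
  refine ⟨√(C₂ * C₃) + √(C₁ * n) + 1, by positivity, fun c u γ u₀ hu0 hγ0 hu hγ => ?_⟩
  -- `adStarMat` takes skew values, so the symmetric part of `u` is constant.
  have hskew : ∀ t, u t = skewPart n (u t) := by
    intro t
    let P : Matrix (Fin n) (Fin n) ℝ →ₗ[ℝ] Matrix (Fin n) (Fin n) ℝ :=
      LinearMap.id - soIncl n ∘ₗ skewPart n
    have h := eq_of_hasDerivAt_zero (f := fun s => P (u s))
      (fun s => (hasDerivAt_linear P (hu s)).congr_deriv ?_) t
    · have h0 : P (u 0) = 0 := by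
        simp [P, hu0, skewPart_coe, soIncl]
      rw [h0] at h
      exact sub_eq_zero.1 h
    · simp [P, adStarMat, soIncl, skewPart_coe]
  have horth : ∀ t, γ t * (γ t)ᵀ = 1 := by
    intro t
    have h := eq_of_hasDerivAt_zero (f := fun s => T (γ s) (γ s))
      (fun s => (hasDerivAt_bilinear T (hγ s) (hγ s)).congr_deriv ?_) t
    · simpa [hT, hγ0] using h
    · have h1 : (u s)ᵀ = -u s := by
        rw [hskew s]
        exact (mem_so _ _ _).1 (skewPart n (u s)).2
      simp [hT, h1, mul_assoc]
  have henergy : ∀ t, H (u t) (u t) = H (u 0) (u 0) := by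
    refine eq_of_hasDerivAt_zero (f := fun s => H (u s) (u s))
      (fun s => (hasDerivAt_bilinear H (hu s) (hu s)).congr_deriv ?_)
    have h1 : H (u s) (M.adStarMat (u s) (u s)) = 0 := by
      simp [H, adStarMat, soIncl, skewPart_coe, g_adStar_self]
    have h2 : H (M.adStarMat (u s) (u s)) (u s) = 0 := by
      rw [← h1]
      exact M.g_symm _ _
    simp [h1, h2]
  intro t
  refine ⟨hskew t, horth t, ?_, ?_⟩
  · have h4 : ‖u t‖ ^ 2 ≤ C₂ * C₃ * ‖u 0‖ ^ 2 := by
      calc ‖u t‖ ^ 2 = ‖skewPart n (u t)‖ ^ 2 := by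
            conv_lhs => rw [hskew t]
            rfl
        _ ≤ C₂ * H (u t) (u t) := h₂ _
        _ ≤ C₂ * (C₃ * ‖u 0‖ ^ 2) := by rw [henergy]; gcongr; exact h₃ _
        _ = _ := by ring
    have h5 : ‖u t‖ ≤ √(C₂ * C₃) * ‖u 0‖ := by
      have := Real.le_sqrt_of_sq_le h4
      rwa [Real.sqrt_mul (by positivity), Real.sqrt_sq (norm_nonneg _)] at this
    refine h5.trans (mul_le_mul_of_nonneg_right ?_ (norm_nonneg _))
    linarith [Real.sqrt_nonneg (C₁ * n)]
  · have h4 := h₁ (γ t)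
    have h5 : B (γ t) (γ t) = n := by
      change trace (γ t * (γ t)ᵀ) = n
      simp [horth]
    rw [h5] at h4
    linarith [Real.le_sqrt_of_sq_le h4, Real.sqrt_nonneg (C₂ * C₃)]

theorem isGeodesicFrom_bounds {C : ℝ} (hC : M.IsAprioriBound C) {γ : ℝ → SOGroup n}
    {u₀ : SoAlg n} (h : M.IsGeodesicFrom γ u₀) :
    ∃ u : ℝ → Matrix (Fin n) (Fin n) ℝ, u 0 = u₀ ∧
      (∀ t, HasDerivAt u (M.adStarMat (u t) (u t)) t) ∧
      (∀ t, HasDerivAt (fun s => (γ s : Matrix (Fin n) (Fin n) ℝ))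
        ((γ t : Matrix (Fin n) (Fin n) ℝ) * u t) t) ∧
      (∀ t, ‖u t‖ ≤ C * ‖(u₀ : Matrix (Fin n) (Fin n) ℝ)‖) ∧
      ∀ t, ‖(γ t : Matrix (Fin n) (Fin n) ℝ)‖ ≤ C := by
  obtain ⟨u, hγ0, hu0, hγ, hu⟩ := h
  have hu' : ∀ t, HasDerivAt (fun s => (u s : Matrix (Fin n) (Fin n) ℝ))
      (M.adStarMat (u t) (u t)) t := fun t => by
    rw [adStarMat_coe]
    exact hu t
  have hb := hC (fun _ => 1) (fun s => u s) (fun s => γ s) u₀ (by rw [hu0]) (by rw [hγ0]; rfl)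
    (fun t => by rw [one_smul]; exact hu' t) (fun t => by rw [one_smul]; exact hγ t)
  refine ⟨fun s => u s, by simp only [hu0], hu', hγ, fun t => ?_, fun t => (hb t).2.2.2⟩
  rw [← hu0]
  exact (hb t).2.2.1

theorem exists_isGeodesicFrom (u₀ : SoAlg n) : ∃ γ, M.IsGeodesicFrom γ u₀ := by
  obtain ⟨C, hC0, hC⟩ := M.exists_apriori_bound
  obtain ⟨u, γ, hu0, hγ0, hu, hγ⟩ := exists_eulerArnold_solution (E := Matrix (Fin n) (Fin n) ℝ)
    (LinearMap.toContinuousBilinearMap M.adStarMat)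
    (R := C * ‖(u₀ : Matrix (Fin n) (Fin n) ℝ)‖ + C) (by positivity) u₀
    (fun c u γ hu0 hγ0 hu hγ t => by
      have h := (hC c u γ u₀ hu0 hγ0 hu hγ t).2.2
      rw [hu0] at h
      exact ⟨h.1.trans (by linarith), h.2.trans (by
        linarith [mul_nonneg hC0.le (norm_nonneg (u₀ : Matrix (Fin n) (Fin n) ℝ))])⟩)
  have hb := hC (fun _ => 1) u γ u₀ hu0 hγ0 (fun t => by rw [one_smul]; exact hu t)
    (fun t => by rw [one_smul]; exact hγ t)
  have horth : ∀ t, γ t ∈ orthogonalGroup (Fin n) ℝ := fun t =>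
    (mem_orthogonalGroup_iff _ _).2 (hb t).2.1
  have hdet : ∀ t, (γ t).det = 1 := by
    have hcont : Continuous fun t => (γ t).det :=
      (continuous_iff_continuousAt.2 fun t => (hγ t).continuousAt : Continuous γ).matrix_det
    have hsq : ∀ t, (γ t).det ^ 2 = 1 := fun t => by
      have := congrArg det (hb t).2.1
      rwa [det_mul, det_transpose, det_one, ← sq] at this
    have := isPreconnected_univ.eq_or_eq_neg_of_sq_eq (f := fun t => (γ t).det) (g := fun _ => 1)
      hcont.continuousOn continuousOn_const (fun t _ => by simp [hsq]) (fun _ => one_ne_zero)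
    rcases this with h | h
    · exact fun t => h (Set.mem_univ t)
    · have h0 := h (Set.mem_univ 0)
      simp [hγ0] at h0
      linarith
  refine ⟨fun t => ⟨γ t, (mem_specialOrthogonalGroup_iff).2 ⟨horth t, hdet t⟩⟩,
    fun t => skewPart n (u t), Subtype.ext hγ0, ?_, fun t => ?_, fun t => ?_⟩
  · simp only [hu0, skewPart_coe]
  · change HasDerivAt γ (γ t * (skewPart n (u t) : Matrix (Fin n) (Fin n) ℝ)) t
    rw [← (hb t).1]
    exact hγ t
  · have h1 : (fun s => (skewPart n (u s) : Matrix (Fin n) (Fin n) ℝ)) = u :=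
      funext fun s => (hb s).1.symm
    rw [h1, ← adStarMat_coe, ← (hb t).1]
    exact hu t

theorem existsUnique_isGeodesicFrom (u₀ : SoAlg n) : ∃! γ, M.IsGeodesicFrom γ u₀ := by
  refine existsUnique_of_exists_of_unique (M.exists_isGeodesicFrom u₀) fun γ η hγ hη => ?_
  obtain ⟨C, hC0, hC⟩ := M.exists_apriori_bound
  obtain ⟨u, hu0, hu, hγ', huR, hγR⟩ := M.isGeodesicFrom_bounds hC hγ
  obtain ⟨v, hv0, hv, hη', hvR, hηR⟩ := M.isGeodesicFrom_bounds hC hη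
  have hnn := mul_nonneg hC0.le (norm_nonneg (u₀ : Matrix (Fin n) (Fin n) ℝ))
  have h := eulerArnold_unique (E := Matrix (Fin n) (Fin n) ℝ)
    (LinearMap.toContinuousBilinearMap M.adStarMat)
    (R := C * ‖(u₀ : Matrix (Fin n) (Fin n) ℝ)‖ + C) (by positivity) hu hγ' hv hη'
    (fun t => (huR t).trans (by linarith)) (fun t => (hγR t).trans (by linarith))
    (fun t => (hvR t).trans (by linarith)) (fun t => (hηR t).trans (by linarith))
    (by rw [hu0, hv0])
    (by
      obtain ⟨-, h1, -⟩ := hγ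
      obtain ⟨-, h2, -⟩ := hη
      rw [h1, h2])
  exact funext fun t => Subtype.ext (congrFun h t)

theorem exists_isGeodesicFrom_riemExp (u₀ : SoAlg n) :
    ∃ γ, M.IsGeodesicFrom γ u₀ ∧ M.riemExp u₀ = γ 1 := by
  have h := M.exists_isGeodesicFrom u₀
  exact ⟨h.choose, h.choose_spec, by simp only [riemExp, dif_pos h]⟩

/-- At a steady velocity the Riemannian exponential map is differentiable, and its derivative is
computed by the linearized Euler–Arnold equation `z' = ad⋆_z u₀ + ad⋆_{u₀} z` together with
`w' = z - [u₀, w]`. -/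
theorem exists_hasFDerivAt_riemExp {u₀ : SoAlg n} (hu₀ : M.IsSteady u₀) :
    ∃ D : SoAlg n →L[ℝ] Matrix (Fin n) (Fin n) ℝ,
      HasFDerivAt (fun u => (M.riemExp u : Matrix (Fin n) (Fin n) ℝ)) D u₀ ∧
      ∀ z w : ℝ → SoAlg n,
        (∀ t, HasDerivAt (fun s => (z s : Matrix (Fin n) (Fin n) ℝ))
          (M.adStar (z t) u₀ + M.adStar u₀ (z t) : SoAlg n) t) →
        (∀ t, HasDerivAt (fun s => (w s : Matrix (Fin n) (Fin n) ℝ))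
          (z t - ⁅u₀, w t⁆ : SoAlg n) t) →
        w 0 = 0 → w 1 = 0 → D (z 0) = 0 := by
  obtain ⟨C, hC0, hC⟩ := M.exists_apriori_bound
  have hN : M.adStarMat u₀ u₀ = 0 := by
    rw [adStarMat_coe, hu₀]
    rfl
  obtain ⟨K, hK⟩ := exists_norm_sub_expDeriv_le (E := Matrix (Fin n) (Fin n) ℝ)
    (LinearMap.toContinuousBilinearMap M.adStarMat) (u₀ := (u₀ : Matrix (Fin n) (Fin n) ℝ)) hN
    (C * (‖(u₀ : Matrix (Fin n) (Fin n) ℝ)‖ + 1) + C)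
  let ι : SoAlg n →L[ℝ] Matrix (Fin n) (Fin n) ℝ := ⟨soIncl n, continuous_subtype_val⟩
  let D' := expDeriv (E := Matrix (Fin n) (Fin n) ℝ)
    (LinearMap.toContinuousBilinearMap M.adStarMat) u₀
  have hquad : ∀ u : SoAlg n, ‖(u : Matrix (Fin n) (Fin n) ℝ) - u₀‖ ≤ 1 →
      ‖(M.riemExp u : Matrix (Fin n) (Fin n) ℝ) -
        NormedSpace.exp (u₀ : Matrix (Fin n) (Fin n) ℝ) -
          D' ((u : Matrix (Fin n) (Fin n) ℝ) - u₀)‖ ≤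
        K * ‖(u : Matrix (Fin n) (Fin n) ℝ) - u₀‖ ^ 2 := by
    intro v hv
    obtain ⟨γ, hγ, hexp⟩ := M.exists_isGeodesicFrom_riemExp v
    obtain ⟨u, hu0, hu, hγ', huR, hγR⟩ := M.isGeodesicFrom_bounds hC hγ
    have hγ0 : (γ 0 : Matrix (Fin n) (Fin n) ℝ) = 1 := by
      obtain ⟨-, h1, -⟩ := hγ
      rw [h1]
      rfl
    have hvn : ‖(v : Matrix (Fin n) (Fin n) ℝ)‖ ≤ ‖(u₀ : Matrix (Fin n) (Fin n) ℝ)‖ + 1 := by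
      have := norm_le_norm_add_norm_sub' (v : Matrix (Fin n) (Fin n) ℝ) u₀
      linarith
    have hCv := mul_le_mul_of_nonneg_left hvn hC0.le
    have h := hK u (fun t => γ t) hγ0 hu hγ'
      (fun t => (huR t).trans (by linarith))
      (fun t => (hγR t).trans (by
        linarith [mul_nonneg hC0.le (norm_nonneg (v : Matrix (Fin n) (Fin n) ℝ))]))
    rw [hu0] at h
    rw [hexp]
    exact h
  have h0 : (M.riemExp u₀ : Matrix (Fin n) (Fin n) ℝ) =
      NormedSpace.exp (u₀ : Matrix (Fin n) (Fin n) ℝ) := by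
    have h := hquad u₀ (by simp)
    rw [sub_self, map_zero, sub_zero, norm_zero, zero_pow two_ne_zero, mul_zero] at h
    exact sub_eq_zero.1 (norm_le_zero_iff.1 h)
  refine ⟨D'.comp ι, ?_, fun z w hz hw hw0 hw1 => ?_⟩
  · refine hasFDerivAt_of_norm_le_sq (V := SoAlg n) (W := Matrix (Fin n) (Fin n) ℝ) (C := K)
      fun u hu => ?_
    rw [h0]
    exact hquad u hu
  · have h := expDeriv_apply_of_jacobi (E := Matrix (Fin n) (Fin n) ℝ)
      (LinearMap.toContinuousBilinearMap M.adStarMat) u₀ (z := fun t => z t) (w := fun t => w t)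
      (fun t => ?_) (fun t => ?_) ?_
    · refine h.trans ?_
      simp [hw1]
    · refine (hz t).congr_deriv ?_
      simp [adStarMat_coe]
    · refine (hw t).congr_deriv ?_
      simp [Ring.lie_def]
    · simp [hw0]

end RigidBodyMetric

end Geodesic

/-! ### The planar Jacobi system -/

section Planar

open Real Set

theorem exists_zero_of_mul_nonpos {f : ℝ → ℝ} (hf : Continuous f) {x y : ℝ} (hxy : x ≤ y)
    (h : f x * f y ≤ 0) : ∃ T, x ≤ T ∧ f T = 0 := by
  rcases mul_nonpos_iff.1 h with h | h
  · obtain ⟨T, hT, h0⟩ := intermediate_value_Icc' hxy hf.continuousOn ⟨h.2, h.1⟩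
    exact ⟨T, hT.1, h0⟩
  · obtain ⟨T, hT, h0⟩ := intermediate_value_Icc hxy hf.continuousOn ⟨h.1, h.2⟩
    exact ⟨T, hT.1, h0⟩

/-- The summand with the larger amplitude dictates the sign of the sum at its extrema. -/
theorem exists_pos_zero_sin_add_sin {X Y α β : ℝ} (hα : 0 < α) (hXY : |Y| ≤ |X|) :
    ∃ T, 0 < T ∧ X * sin (α * T) + Y * sin (β * T) = 0 := by
  have hle : π / (2 * α) ≤ 3 * π / (2 * α) := by
    gcongr
    linarith [pi_pos]
  obtain ⟨T, hT, h0⟩ := exists_zero_of_mul_nonpos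
    (f := fun T => X * sin (α * T) + Y * sin (β * T)) (by fun_prop) hle (by
      have e1 : α * (π / (2 * α)) = π / 2 := by field_simp
      have e2 : α * (3 * π / (2 * α)) = π / 2 + π := by field_simp; ring
      simp only [e1, e2, sin_add_pi, sin_pi_div_two]
      have hb : ∀ s, |Y * sin s| ≤ |X| := fun s => by
        rw [abs_mul]
        exact (mul_le_of_le_one_right (abs_nonneg _) (abs_sin_le_one s)).trans hXY
      have h1 := abs_le.1 (hb (β * (π / (2 * α))))
      have h2 := abs_le.1 (hb (β * (3 * π / (2 * α))))
      rcases abs_cases X with ⟨hX, _⟩ | ⟨hX, _⟩ <;> rw [hX] at h1 h2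
      · exact mul_nonpos_of_nonneg_of_nonpos (by linarith) (by linarith)
      · exact mul_nonpos_of_nonpos_of_nonneg (by linarith) (by linarith))
  exact ⟨T, lt_of_lt_of_le (by positivity) hT, h0⟩

theorem exists_pos_zero_sin_cos {A B ω : ℝ} (hω : 0 < ω) (hω1 : ω ≠ 1) :
    ∃ T, 0 < T ∧ A * sin (ω * T) * cos T + B * cos (ω * T) * sin T = 0 := by
  have key : ∀ T, A * sin (ω * T) * cos T + B * cos (ω * T) * sin T =
      (A + B) / 2 * sin ((1 + ω) * T) + (B - A) / 2 * sin ((1 - ω) * T) := fun T => by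
    rw [add_mul, sub_mul, one_mul, sin_add, sin_sub]
    ring
  simp only [key]
  rcases le_total |(B - A) / 2| |(A + B) / 2| with h | h
  · exact exists_pos_zero_sin_add_sin (by linarith) h
  · rcases lt_or_gt_of_ne hω1 with h1 | h1
    · obtain ⟨T, hT, h0⟩ := exists_pos_zero_sin_add_sin (α := 1 - ω) (β := 1 + ω) (by linarith) h
      exact ⟨T, hT, by linarith⟩
    · obtain ⟨T, hT, h0⟩ := exists_pos_zero_sin_add_sin (X := -((B - A) / 2)) (Y := (A + B) / 2)
        (α := ω - 1) (β := 1 + ω) (by linarith) (by rwa [abs_neg])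
      refine ⟨T, hT, ?_⟩
      rw [show (1 - ω) * T = -((ω - 1) * T) by ring, sin_neg]
      linarith

/-- The coordinates of a Jacobi field in a plane spanned by `e i k` and `e j k`: `(a, b)` solves the
linearized Euler–Arnold equation with coefficients `p` and `q`, and `(w₁, w₂)` is the
left-translated Jacobi field, which vanishes at the times `0` and `τ`. -/
structure IsPlanarJacobi (p q τ : ℝ) (a b w₁ w₂ : ℝ → ℝ) : Prop where
  hasDerivAt_a : ∀ t, HasDerivAt a (p * b t) t
  hasDerivAt_b : ∀ t, HasDerivAt b (-(q * a t)) t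
  hasDerivAt_fst : ∀ t, HasDerivAt w₁ (a t + w₂ t) t
  hasDerivAt_snd : ∀ t, HasDerivAt w₂ (b t - w₁ t) t
  fst_zero : w₁ 0 = 0
  snd_zero : w₂ 0 = 0
  fst_end : w₁ τ = 0
  snd_end : w₂ τ = 0
  ne_zero : ¬(a 0 = 0 ∧ b 0 = 0)

/-- The solutions on `[-T, T]` with `a`, `w₂` even and `b`, `w₁` odd form a two-dimensional space.
One of them vanishes at an endpoint, and so at both, if `T` solves the single equation `hT`. The
solution is shifted in time to start at `0`. -/
theorem exists_isPlanarJacobi_of_zero {p q : ℝ} (hpq : p * q ≠ 1) {C S : ℝ → ℝ}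
    (hS : ∀ t, HasDerivAt S (C t) t) (hC : ∀ t, HasDerivAt C (-(p * q * S t)) t)
    (hSodd : ∀ t, S (-t) = -S t) (hCeven : ∀ t, C (-t) = C t)
    (hne : ∀ t, C t = 0 → q * S t ≠ 0) {T : ℝ}
    (hT : (1 + p) * q * S T * cos T - (1 + q) * C T * sin T = 0) :
    ∃ a b w₁ w₂, IsPlanarJacobi p q (2 * T) a b w₁ w₂ := by
  have hpq' : 1 - p * q ≠ 0 := sub_ne_zero.2 hpq.symm
  -- Off resonance, `(k b, l a)` is a particular solution for `(w₁, w₂)`, to which a multiple `β` of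
  -- the homogeneous solution `(sin, cos)` is added.
  obtain ⟨k, hk⟩ : ∃ k, k * (1 - p * q) = 1 + p := ⟨(1 + p) / (1 - p * q), div_mul_cancel₀ _ hpq'⟩
  obtain ⟨l, hl⟩ : ∃ l, l * (1 - p * q) = -(1 + q) :=
    ⟨-(1 + q) / (1 - p * q), div_mul_cancel₀ _ hpq'⟩
  have hkl1 : l = -1 - k * q := by
    refine mul_right_cancel₀ hpq' ?_
    linear_combination hl + q * hk
  have hkl2 : k = 1 - l * p := by
    refine mul_right_cancel₀ hpq' ?_
    linear_combination hk + p * hl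
  have hf : k * q * S T * cos T + l * C T * sin T = 0 := by
    refine mul_right_cancel₀ hpq' ?_
    linear_combination hT + q * S T * cos T * hk + C T * sin T * hl
  -- By `hf`, the particular solution at `T` is proportional to `(sin T, cos T)`.
  set β : ℝ := k * q * S T * sin T - l * C T * cos T with hβ
  have hsc := sin_sq_add_cos_sq T
  have e1 : -(k * q * S T) + β * sin T = 0 := by
    linear_combination sin T * hβ - cos T * hf + k * q * S T * hsc
  have e2 : l * C T + β * cos T = 0 := by
    linear_combination cos T * hβ + sin T * hf - l * C T * hsc
  have hS' : ∀ t, HasDerivAt (fun t => S (t - T)) (C (t - T)) t := fun t =>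
    (hS (t - T)).comp_sub_const t T
  have hC' : ∀ t, HasDerivAt (fun t => C (t - T)) (-(p * q * S (t - T))) t := fun t =>
    (hC (t - T)).comp_sub_const t T
  have hs : ∀ t, HasDerivAt (fun t => sin (t - T)) (cos (t - T)) t := fun t =>
    (hasDerivAt_sin (t - T)).comp_sub_const t T
  have hc : ∀ t, HasDerivAt (fun t => cos (t - T)) (-sin (t - T)) t := fun t =>
    (hasDerivAt_cos (t - T)).comp_sub_const t T
  refine ⟨fun t => C (t - T), fun t => -(q * S (t - T)),
    fun t => -(k * q * S (t - T)) + β * sin (t - T), fun t => l * C (t - T) + β * cos (t - T),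
    ⟨fun t => ?_, fun t => ?_, fun t => ?_, fun t => ?_, ?_, ?_, ?_, ?_, ?_⟩⟩
  · exact (hC' t).congr_deriv (by ring)
  · exact ((hS' t).const_mul q).neg
  · refine (((hS' t).const_mul (k * q)).neg.add ((hs t).const_mul β)).congr_deriv ?_
    linear_combination C (t - T) * -hkl1
  · refine (((hC' t).const_mul l).add ((hc t).const_mul β)).congr_deriv ?_
    linear_combination q * S (t - T) * -hkl2
  · simp only [zero_sub, hSodd, sin_neg]
    linear_combination -e1
  · simp only [zero_sub, hCeven, cos_neg]
    exact e2
  · rw [show 2 * T - T = T by ring]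
    exact e1
  · rw [show 2 * T - T = T by ring]
    exact e2
  · rintro ⟨h1, h2⟩
    exact hne _ h1 (neg_eq_zero.1 h2)

/-- If `S` is positive at `π` and at `2π`, then the endpoint condition changes sign in between. -/
theorem exists_isPlanarJacobi_of_pos {p q : ℝ} (hpq : p * q ≠ 1) {C S : ℝ → ℝ}
    (hS : ∀ t, HasDerivAt S (C t) t) (hC : ∀ t, HasDerivAt C (-(p * q * S t)) t)
    (hSodd : ∀ t, S (-t) = -S t) (hCeven : ∀ t, C (-t) = C t)
    (hne : ∀ t, C t ≠ 0) (hpos : ∀ t, 0 < t → 0 < S t) :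
    ∃ τ, 0 < τ ∧ ∃ a b w₁ w₂, IsPlanarJacobi p q τ a b w₁ w₂ := by
  have hScont : Continuous S := continuous_iff_continuousAt.2 fun t => (hS t).continuousAt
  have hCcont : Continuous C := continuous_iff_continuousAt.2 fun t => (hC t).continuousAt
  obtain ⟨T, hT, h0⟩ := exists_zero_of_mul_nonpos
    (f := fun T => (1 + p) * q * S T * cos T - (1 + q) * C T * sin T) (by fun_prop)
    (show π ≤ 2 * π by linarith [pi_pos]) (by
      have := mul_pos (hpos π pi_pos) (hpos (2 * π) two_pi_pos)
      simp only [cos_pi, sin_pi, cos_two_pi, sin_two_pi]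
      nlinarith [mul_nonneg (sq_nonneg ((1 + p) * q)) this.le])
  exact ⟨2 * T, by linarith [pi_pos],
    exists_isPlanarJacobi_of_zero hpq hS hC hSodd hCeven (fun t h => absurd h (hne t)) h0⟩

theorem exists_isPlanarJacobi {p q : ℝ} (hpq : p * q = 1 → p = -1 ∧ q = -1) :
    ∃ τ, 0 < τ ∧ ∃ a b w₁ w₂, IsPlanarJacobi p q τ a b w₁ w₂ := by
  by_cases h1 : p * q = 1
  · -- At resonance the Jacobi field `sin t • (1, 0)` vanishes at `π`.
    obtain ⟨rfl, rfl⟩ := hpq h1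
    refine ⟨π, pi_pos, cos, sin, sin, fun _ => 0, fun t => ?_, fun t => ?_, fun t => ?_,
      fun t => ?_, sin_zero, rfl, sin_pi, rfl, by simp⟩
    · exact (hasDerivAt_cos t).congr_deriv (by ring)
    · exact (hasDerivAt_sin t).congr_deriv (by ring)
    · exact (hasDerivAt_sin t).congr_deriv (by ring)
    · exact (hasDerivAt_const t (0 : ℝ)).congr_deriv (by ring)
  rcases lt_trichotomy (p * q) 0 with h | h | h
  · obtain ⟨ω, hω, hr⟩ : ∃ ω : ℝ, 0 < ω ∧ p * q = -ω ^ 2 :=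
      ⟨√(-(p * q)), sqrt_pos.2 (by linarith), by rw [sq_sqrt (by linarith)]; ring⟩
    have hlin : ∀ t : ℝ, HasDerivAt (fun t => ω * t) ω t := fun t => by
      simpa using (hasDerivAt_id t).const_mul ω
    refine exists_isPlanarJacobi_of_pos h1 (C := fun t => cosh (ω * t))
      (S := fun t => sinh (ω * t) / ω) (fun t => ?_) (fun t => ?_) (fun t => ?_) (fun t => ?_)
      (fun t => (cosh_pos _).ne') (fun t ht => div_pos (sinh_pos_iff.2 (by positivity)) hω)
    · exact ((hlin t).sinh.div_const ω).congr_deriv (by field_simp)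
    · exact (hlin t).cosh.congr_deriv (by rw [hr]; field_simp)
    · simp only [mul_neg, sinh_neg, neg_div]
    · simp only [mul_neg, cosh_neg]
  · exact exists_isPlanarJacobi_of_pos h1 (C := fun _ => 1) (S := fun t => t)
      (fun t => hasDerivAt_id t) (fun t => (hasDerivAt_const t (1 : ℝ)).congr_deriv (by simp [h]))
      (fun _ => rfl) (fun _ => rfl) (fun _ => one_ne_zero) (fun _ ht => ht)
  · obtain ⟨ω, hω, hr⟩ : ∃ ω : ℝ, 0 < ω ∧ p * q = ω ^ 2 :=
      ⟨√(p * q), sqrt_pos.2 h, by rw [sq_sqrt h.le]⟩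
    have hω1 : ω ≠ 1 := by
      rintro rfl
      exact h1 (by rw [hr, one_pow])
    have hlin : ∀ t : ℝ, HasDerivAt (fun t => ω * t) ω t := fun t => by
      simpa using (hasDerivAt_id t).const_mul ω
    obtain ⟨T, hT, h0⟩ := exists_pos_zero_sin_cos (A := (1 + p) * q / ω) (B := -(1 + q)) hω hω1
    refine ⟨2 * T, by positivity, exists_isPlanarJacobi_of_zero h1 (C := fun t => cos (ω * t))
      (S := fun t => sin (ω * t) / ω) (fun t => ?_) (fun t => ?_) (fun t => ?_) (fun t => ?_)
      (fun t hc hs => ?_) ?_⟩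
    · exact ((hlin t).sin.div_const ω).congr_deriv (by field_simp)
    · exact (hlin t).cos.congr_deriv (by rw [hr]; field_simp)
    · simp only [mul_neg, sin_neg, neg_div]
    · simp only [mul_neg, cos_neg]
    · have hq : q ≠ 0 := by
        rintro rfl
        simp at h
      have hs' : sin (ω * t) = 0 := by
        simpa [hq, hω.ne'] using hs
      have := sin_sq_add_cos_sq (ω * t)
      rw [hs', hc] at this
      norm_num at this
    · linear_combination h0

end Planar

/-! ### Brackets of the basis vectors -/

section Brackets

variable {n : ℕ}

theorem e_swap (i j : Fin n) : (e j i : SoAlg n) = -e i j :=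
  Subtype.ext (by simp [e])

theorem e_self (i : Fin n) : (e i i : SoAlg n) = 0 :=
  Subtype.ext (by simp [e])

theorem e_apply_self {i j : Fin n} (h : i ≠ j) :
    (e i j : SoAlg n).1 j i = 1 := by
  simp [e, h]

theorem lie_e_fst {i j k : Fin n} (hij : i ≠ j) (hik : i ≠ k) (hjk : j ≠ k) :
    ⁅(e i j : SoAlg n), e i k⁆ = e j k := by
  apply Subtype.ext
  simp [e, Ring.lie_def, sub_mul, mul_sub, single_mul_single_of_ne, hij, hik, hjk, hij.symm,
    hik.symm, hjk.symm]
  abel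

theorem lie_e_snd {i j k : Fin n} (hij : i ≠ j) (hik : i ≠ k) (hjk : j ≠ k) :
    ⁅(e i j : SoAlg n), e j k⁆ = -e i k := by
  rw [← neg_neg (e i j), ← e_swap, neg_lie, lie_e_fst hij.symm hjk hik]

theorem lie_e_disjoint {i j k l : Fin n} (hik : i ≠ k) (hil : i ≠ l) (hjk : j ≠ k) (hjl : j ≠ l) :
    ⁅(e i j : SoAlg n), e k l⁆ = 0 := by
  apply Subtype.ext
  simp [e, Ring.lie_def, sub_mul, mul_sub, single_mul_single_of_ne, hik, hil, hjk, hjl, hik.symm,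
    hil.symm, hjk.symm, hjl.symm]

end Brackets

namespace RigidBodyMetric

variable {n : ℕ} (M : RigidBodyMetric n)

/-- The form `biForm` is ad-invariant. -/
theorem biForm_lie (u v w : SoAlg n) : biForm n ⁅u, v⁆ w = -biForm n v ⁅u, w⁆ := by
  have hv := (mem_so _ _ _).1 v.2
  have hu := (mem_so _ _ _).1 u.2
  have hw := (mem_so _ _ _).1 w.2
  simp only [biForm, LinearMap.mk₂_apply, LieSubalgebra.coe_bracket, Ring.lie_def,
    transpose_sub, transpose_mul, hu, hw, sub_mul, mul_sub, trace_sub, mul_neg, neg_mul,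
    neg_neg, trace_neg]
  rw [← mul_assoc, ← mul_assoc, trace_mul_cycle u.1 v.1 w.1, trace_mul_cycle v.1 w.1 u.1,
    trace_mul_cycle u.1 v.1 w.1]

theorem op_injective : Function.Injective M.op := by
  rw [← LinearMap.ker_eq_bot, LinearMap.ker_eq_bot']
  intro u hu
  by_contra h
  have := M.pos u h
  rw [hu, map_zero] at this
  exact lt_irrefl _ this

/-- The Euler–Arnold equation in momentum form: `Λ (ad⋆_u v) = [Λ v, u]`. -/
theorem op_adStar (u v : SoAlg n) : M.op (M.adStar u v) = ⁅M.op v, u⁆ := by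
  have key : ∀ w, biForm n (M.op (M.adStar u v) - ⁅M.op v, u⁆) w = 0 := by
    intro w
    have h1 : biForm n (M.adStar u v) (M.op w) = biForm n v (M.op ⁅u, w⁆) := M.g_adStar u v w
    rw [map_sub, LinearMap.sub_apply, M.symm, h1, ← M.symm, ← lie_skew (M.op v) u, map_neg,
      LinearMap.neg_apply, biForm_lie]
    ring
  by_contra h
  exact (biForm_self_pos (sub_ne_zero.2 h)).ne' (key _)

theorem adStar_eq_smul {u v x : SoAlg n} {a b s : ℝ} (hv : M.op v = a • v) (hx : M.op x = b • x)
    (hb : b ≠ 0) (h : ⁅v, u⁆ = s • x) : M.adStar u v = (a * s / b) • x := by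
  apply M.op_injective
  rw [op_adStar, hv, smul_lie, h, map_smul, hx, smul_smul, smul_smul]
  congr 1
  field_simp

theorem isSteady_of_op_eq_smul {u : SoAlg n} {a : ℝ} (hu : M.op u = a • u) : M.IsSteady u := by
  apply M.op_injective
  rw [op_adStar, hu, smul_lie, lie_self, smul_zero, map_zero]

theorem IsSteady.smul {M : RigidBodyMetric n} {u : SoAlg n} (h : M.IsSteady u) (r : ℝ) :
    M.IsSteady (r • u) := by
  have h' : M.adStar u u = 0 := h
  simp [IsSteady, h']

theorem exists_op_e (i j : Fin n) (hij : i ≠ j) :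
    ∃ c : ℝ, 0 < c ∧ M.op (e i j) = c • e i j := by
  obtain ⟨c, hc⟩ : ∃ c : ℝ, M.op (e i j) = c • e i j := by
    rcases lt_or_gt_of_ne hij with h | h
    · exact M.eigen i j h
    · obtain ⟨c, hc⟩ := M.eigen j i h
      exact ⟨c, by rw [e_swap j i, map_neg, hc, smul_neg]⟩
  refine ⟨c, ?_, hc⟩
  have hne : (e i j : SoAlg n) ≠ 0 := fun h => by
    have := e_apply_self hij
    rw [h] at this
    simp at this
  have hpos := M.pos _ hne
  rw [hc, map_smul, smul_eq_mul] at hpos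
  exact pos_of_mul_pos_left hpos (biForm_self_pos hne).le

section Conjugate

attribute [local instance] Matrix.linftyOpNormedRing Matrix.linftyOpNormedAlgebra

/-- Along the steady geodesic generated by `e i j`, the Jacobi equation leaves each plane spanned by
`e i k` and `e j k` invariant, and there it is the planar Jacobi system. -/
theorem exists_isConjugateTime {i j k : Fin n} (hij : i ≠ j) (hik : i ≠ k) (hjk : j ≠ k) :
    ∃ τ : ℝ, 0 < τ ∧ M.IsConjugateTime (e i j) τ := by
  obtain ⟨c, hc, hce⟩ := M.exists_op_e i j hij
  obtain ⟨c₁, hc₁, hce₁⟩ := M.exists_op_e i k hik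
  obtain ⟨c₂, hc₂, hce₂⟩ := M.exists_op_e j k hjk
  obtain ⟨τ, hτ, a, b, w₁, w₂, hJ⟩ := exists_isPlanarJacobi (p := (c₂ - c) / c₁)
    (q := (c₁ - c) / c₂) (fun h => by
      have h1 : c * (c - (c₁ + c₂)) = 0 := by
        field_simp at h
        linarith
      have h2 : c = c₁ + c₂ := by
        rcases mul_eq_zero.1 h1 with h1 | h1
        · exact absurd h1 hc.ne'
        · linarith
      subst h2
      constructor <;> field_simp <;> ring)
  obtain ⟨D, hD, hDz⟩ := M.exists_hasFDerivAt_riemExp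
    ((M.isSteady_of_op_eq_smul hce).smul τ)
  refine ⟨τ, hτ, D, hD, fun hinj => ?_⟩
  have b1 := lie_e_fst hij hik hjk
  have b2 := lie_e_snd hij hik hjk
  have b3 : ⁅(e i k : SoAlg n), e i j⁆ = -e j k := by rw [← lie_skew, b1]
  have b4 : ⁅(e j k : SoAlg n), e i j⁆ = e i k := by rw [← lie_skew, b2, neg_neg]
  have s1 := M.adStar_eq_smul (u := e i k) (s := 1) hce hce₂ hc₂.ne' (by rw [b1, one_smul])
  have s2 := M.adStar_eq_smul (u := e j k) (s := -1) hce hce₁ hc₁.ne' (by rw [b2, neg_one_smul])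
  have s3 := M.adStar_eq_smul (u := e i j) (s := -1) hce₁ hce₂ hc₂.ne' (by rw [b3, neg_one_smul])
  have s4 := M.adStar_eq_smul (u := e i j) (s := 1) hce₂ hce₁ hc₁.ne' (by rw [b4, one_smul])
  -- The planar solution on `[0, τ]` for the velocity `e i j`, rescaled to `[0, 1]` and `τ • e i j`.
  let z : ℝ → SoAlg n := fun t => (τ * a (τ * t)) • e i k + (τ * b (τ * t)) • e j k
  let w : ℝ → SoAlg n := fun t => w₁ (τ * t) • e i k + w₂ (τ * t) • e j k
  have hcomb : ∀ (f g : ℝ → ℝ) (f' g' t : ℝ), HasDerivAt f f' t → HasDerivAt g g' t →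
      HasDerivAt (fun s => ((f s • e i k + g s • e j k : SoAlg n) : Matrix (Fin n) (Fin n) ℝ))
        ((f' • e i k + g' • e j k : SoAlg n) : Matrix (Fin n) (Fin n) ℝ) t :=
    fun f g f' g' t hf hg => 
      (hf.smul_const (e i k : Matrix (Fin n) (Fin n) ℝ)).fun_add
        (hg.smul_const (e j k : Matrix (Fin n) (Fin n) ℝ))
  have hscale : ∀ {f : ℝ → ℝ} {f' t : ℝ}, HasDerivAt f f' (τ * t) →
      HasDerivAt (fun s => f (τ * s)) (τ * f') t := fun {f f' t} hf => by
    have h1 : HasDerivAt (fun s => τ * s) τ t := by simpa using (hasDerivAt_id t).const_mul τ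
    exact (hf.comp t h1).congr_deriv (mul_comm _ _)
  have h0 : D (z 0) = 0 := by
    refine hDz z w (fun t => ?_) (fun t => ?_) ?_ ?_
    · refine (hcomb _ _ _ _ t ((hscale (hJ.hasDerivAt_a _)).const_mul τ)
        ((hscale (hJ.hasDerivAt_b _)).const_mul τ)).congr_deriv (congrArg Subtype.val ?_)
      simp only [z, map_add, map_smul, LinearMap.add_apply, LinearMap.smul_apply, s1, s2, s3, s4]
      module
    · refine (hcomb _ _ _ _ t (hscale (hJ.hasDerivAt_fst _))
        (hscale (hJ.hasDerivAt_snd _))).congr_deriv (congrArg Subtype.val ?_)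
      simp only [z, w, lie_add, lie_smul, smul_lie, b1, b2]
      module
    · simp [w, hJ.fst_zero, hJ.snd_zero]
    · simp [w, hJ.fst_end, hJ.snd_end]
  have hz : z 0 = 0 := hinj (h0.trans (map_zero D).symm)
  refine hJ.ne_zero ⟨?_, ?_⟩
  · have := congrFun (congrFun (congrArg Subtype.val hz) k) i
    simpa [z, e, hij, hik, hjk, hij.symm, hik.symm, hjk.symm, hτ.ne'] using this
  · have := congrFun (congrFun (congrArg Subtype.val hz) k) j
    simpa [z, e, hij, hik, hjk, hij.symm, hik.symm, hjk.symm, hτ.ne'] using this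

end Conjugate

end RigidBodyMetric

/-! ### Negative Ricci curvature -/

variable {n : ℕ}

theorem coe_smul_apply (r : ℝ) (u : SoAlg n) (a b : Fin n) : (r • u).1 a b = r * u.1 a b := rfl

theorem eq_sum_smul_e (u : SoAlg n) : u = ∑ i, ∑ j, ((1 / 2 : ℝ) * u.1 j i) • e i j := by
  have hcoe : ∀ x : SoAlg n, x.1 = soIncl n x := fun _ => rfl
  have hskew : ∀ a b, u.1 b a = -u.1 a b := fun a b => by
    have := congrFun (congrFun ((mem_so _ _ _).1 u.2) a) b
    simpa using this
  apply Subtype.ext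
  ext a b
  rw [hcoe (∑ i, _)]
  simp only [map_sum, map_smul, Matrix.sum_apply, Matrix.smul_apply]
  simp only [soIncl, e, LinearMap.coe_mk, AddHom.coe_mk, Matrix.sub_apply, single_apply,
    smul_eq_mul,
    mul_sub, Finset.sum_sub_distrib, ite_and, mul_ite, mul_one, mul_zero, Finset.sum_ite_irrel,
    Finset.sum_ite_eq', Finset.mem_univ, if_true, Finset.sum_const_zero]
  rw [hskew a b]
  ring

/-- The factor `1 / 2` accounts for the sum over all pairs, in which every basis vector occurs twice
up to sign. -/
theorem trace_eq_sum (f : SoAlg n →ₗ[ℝ] SoAlg n) :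
    LinearMap.trace ℝ (SoAlg n) f = 1 / 2 * ∑ i, ∑ j, (f (e i j)).1 j i := by
  let φ : Fin n → Fin n → SoAlg n →ₗ[ℝ] ℝ := fun i j =>
    (1 / 2 : ℝ) • (Matrix.entryLinearMap ℝ ℝ j i ∘ₗ soIncl n)
  have h : f = ∑ i, ∑ j, (φ i j).smulRight (f (e i j)) := by
    ext1 u
    conv_lhs => rw [eq_sum_smul_e u]
    simp [φ, soIncl]
  conv_lhs => rw [h]
  simp only [map_sum, LinearMap.trace_smulRight, Finset.mul_sum]
  rfl

theorem biForm_apply_sum (u v : SoAlg n) :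
    biForm n u v = 1 / 2 * ∑ i, ∑ j, u.1 i j * v.1 i j := by
  simp [biForm, trace, mul_apply]

/-- The metric for which every `e i j` has the eigenvalue `c i j`. -/
def diagonalMetric (c : Fin n → Fin n → ℝ) (hc : ∀ a b, c a b = c b a) (hpos : ∀ a b, 1 ≤ c a b) :
    RigidBodyMetric n where
  op :=
    { toFun := fun u => ⟨of fun a b => c a b * u.1 a b, by
        rw [mem_so]
        ext a b
        have := congrFun (congrFun ((mem_so _ _ _).1 u.2) a) b
        simp only [transpose_apply, Matrix.neg_apply] at this
        simp [this, hc b a]⟩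
      map_add' := fun u v => Subtype.ext (by ext a b; simp [mul_add])
      map_smul' := fun r u => Subtype.ext (by ext a b; simp; ring) }
  symm u v := by
    simp only [biForm_apply_sum, LinearMap.coe_mk, AddHom.coe_mk, of_apply]
    congr 1
    refine Finset.sum_congr rfl fun i _ => Finset.sum_congr rfl fun j _ => by ring
  eigen i j _ := by
    refine ⟨c i j, Subtype.ext ?_⟩
    ext a b
    simp only [e, LinearMap.coe_mk, AddHom.coe_mk, of_apply, Matrix.sub_apply, single_apply,
      coe_smul_apply]
    grind
  pos u hu := by
    refine (biForm_self_pos hu).trans_le ?_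
    simp only [biForm_apply_sum, LinearMap.coe_mk, AddHom.coe_mk, of_apply]
    refine mul_le_mul_of_nonneg_left (Finset.sum_le_sum fun i _ => Finset.sum_le_sum fun j _ => ?_)
      (by norm_num)
    nlinarith [hpos i j, mul_self_nonneg (u.1 i j)]

theorem diagonalMetric_op_e (c : Fin n → Fin n → ℝ) (hc : ∀ a b, c a b = c b a)
    (hpos : ∀ a b, 1 ≤ c a b) (i j : Fin n) :
    (diagonalMetric c hc hpos).op (e i j) = c i j • e i j := by
  apply Subtype.ext
  ext a b
  simp only [diagonalMetric, e, LinearMap.coe_mk, AddHom.coe_mk, of_apply, Matrix.sub_apply,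
    single_apply, coe_smul_apply]
  grind

namespace RigidBodyMetric

variable (M : RigidBodyMetric n)

theorem nabla_apply (u v : SoAlg n) :
    M.nabla u v = (1 / 2 : ℝ) • (⁅u, v⁆ - M.adStar u v - M.adStar v u) := by
  simp [nabla]

theorem curv_apply (v w u : SoAlg n) :
    M.curv v w u = M.nabla u (M.nabla v w) - M.nabla v (M.nabla u w) - M.nabla ⁅u, v⁆ w := by
  simp [curv]

theorem nabla_eq_smul {u v x : SoAlg n} {a b c s : ℝ} (hu : M.op u = a • u) (hv : M.op v = b • v)
    (hx : M.op x = c • x) (hc : c ≠ 0) (h : ⁅u, v⁆ = s • x) :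
    M.nabla u v = (s / 2 * (1 + (b - a) / c)) • x := by
  have h' : ⁅v, u⁆ = (-s) • x := by rw [← lie_skew, h, neg_smul]
  rw [nabla_apply, M.adStar_eq_smul hv hx hc h', M.adStar_eq_smul hu hx hc h, h]
  module

theorem nabla_eq_zero {u v : SoAlg n} {a b : ℝ} (hu : M.op u = a • u) (hv : M.op v = b • v)
    (h : ⁅u, v⁆ = 0) : M.nabla u v = 0 := by
  have h' : ⁅v, u⁆ = 0 := by rw [← lie_skew, h, neg_zero]
  have h1 : M.adStar u v = 0 := M.op_injective (by rw [op_adStar, hv, smul_lie, h']; simp)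
  have h2 : M.adStar v u = 0 := M.op_injective (by rw [op_adStar, hu, smul_lie, h]; simp)
  rw [nabla_apply, h, h1, h2]
  simp

/-- The metric gives the eigenvalue `3` to `e j k` for all `k ≠ i` and `1` to all other basis
vectors. Then `u ↦ R(u, e i j) e i j` has the eigenvalue `-5/4` on each `e i k` and `3/4` on each `e
j k`, and vanishes on the other basis vectors. The Ricci curvature is therefore `-(n - 2) / 2`. -/
theorem exists_ricci_neg (i j k : Fin n) (hij : i ≠ j) (hik : i ≠ k) (hjk : j ≠ k) :
    ∃ M : RigidBodyMetric n, M.ricci (e i j) (e i j) < 0 := by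
  let c : Fin n → Fin n → ℝ := fun a b =>
    if (a = j ∧ b ≠ i) ∨ (b = j ∧ a ≠ i) then 3 else 1
  have hc : ∀ a b, c a b = c b a := fun a b => by simp only [c, or_comm]
  have hpos : ∀ a b, 1 ≤ c a b := fun a b => by simp only [c]; split_ifs <;> norm_num
  let M := diagonalMetric c hc hpos
  have hop : ∀ a b, M.op (e a b) = c a b • e a b := diagonalMetric_op_e c hc hpos
  have hij' : M.op (e i j) = (1 : ℝ) • e i j := by
    rw [hop]; congr 1; simp [c, hij]
  have hself : M.nabla (e i j) (e i j) = 0 := M.nabla_eq_zero hij' hij' (lie_self _)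
  have hfst : ∀ k, i ≠ k → j ≠ k → M.curv (e i j) (e i j) (e i k) = (-5 / 4 : ℝ) • e i k ∧
      M.curv (e i j) (e i j) (e j k) = (3 / 4 : ℝ) • e j k := by
    intro k hik hjk
    have h1 : M.op (e i k) = (1 : ℝ) • e i k := by
      rw [hop]; congr 1; simp [c, hij, hjk.symm]
    have h2 : M.op (e j k) = (3 : ℝ) • e j k := by
      rw [hop]; congr 1; simp [c, hik.symm]
    have b1 := lie_e_fst hij hik hjk
    have b2 := lie_e_snd hij hik hjk
    have b3 : ⁅(e i k : SoAlg n), e i j⁆ = -e j k := by rw [← lie_skew, b1]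
    have b4 : ⁅(e j k : SoAlg n), e i j⁆ = e i k := by rw [← lie_skew, b2, neg_neg]
    have n1 := M.nabla_eq_smul (s := 1) hij' h1 h2 (by norm_num) (by rw [b1, one_smul])
    have n2 := M.nabla_eq_smul (s := -1) hij' h2 h1 (by norm_num) (by rw [b2, neg_one_smul])
    have n3 := M.nabla_eq_smul (s := -1) h1 hij' h2 (by norm_num) (by rw [b3, neg_one_smul])
    have n4 := M.nabla_eq_smul (s := 1) h2 hij' h1 (by norm_num) (by rw [b4, one_smul])
    constructor
    · rw [curv_apply, hself, n3, b3, map_zero, map_smul, map_neg, LinearMap.neg_apply, n2, n4]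
      module
    · rw [curv_apply, hself, n4, b4, map_zero, map_smul, n1, n3]
      module
  -- The trace runs over ordered pairs, so each eigenvalue occurs at `(a, b)` and at `(b, a)`; the
  -- function `P` holds the share of one of the two orders.
  let P : Fin n → Fin n → ℝ := fun a b =>
    if b = i ∨ b = j then 0 else (if a = i then -5 / 4 else 0) + if a = j then 3 / 4 else 0
  have hF : ∀ a b, (M.curv (e i j) (e i j) (e a b)).1 b a = P a b + P b a := by
    have hflip : ∀ a b, (M.curv (e i j) (e i j) (e a b)).1 b a =
        (M.curv (e i j) (e i j) (e b a)).1 a b := by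
      intro a b
      have := congrFun (congrFun ((mem_so _ _ _).1 (M.curv (e i j) (e i j) (e b a)).2) b) a
      rw [e_swap b a, map_neg]
      simp only [transpose_apply, Matrix.neg_apply] at this
      rw [this]
      rfl
    have hA : ∀ b, i ≠ b → j ≠ b → (M.curv (e i j) (e i j) (e i b)).1 b i = -5 / 4 := by
      intro b h1 h2
      rw [(hfst b h1 h2).1, coe_smul_apply, e_apply_self h1]
      simp
    have hB : ∀ b, i ≠ b → j ≠ b → (M.curv (e i j) (e i j) (e j b)).1 b j = 3 / 4 := by
      intro b h1 h2
      rw [(hfst b h1 h2).2, coe_smul_apply, e_apply_self h2]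
      simp
    have hzero : (M.curv (e i j) (e i j) (e i j)).1 j i = 0 := by
      rw [curv_apply, hself, lie_self]
      simp
    have hdiag : ∀ a, (M.curv (e i j) (e i j) (e a a)).1 a a = 0 := by
      intro a
      rw [e_self, map_zero]
      rfl
    have hdisj : ∀ a b, i ≠ a → i ≠ b → j ≠ a → j ≠ b →
        (M.curv (e i j) (e i j) (e a b)).1 b a = 0 := by
      intro a b h1 h2 h3 h4
      have hb := lie_e_disjoint h1.symm h3.symm h2.symm h4.symm
      rw [curv_apply, hself, hb, M.nabla_eq_zero (hop a b) hij' hb]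
      simp
    intro a b
    by_cases ha : i = a
    · subst ha
      by_cases hb : i = b
      · subst hb
        rw [hdiag]; simp [P]
      by_cases hb' : j = b
      · subst hb'
        rw [hzero]; simp [P]
      · rw [hA b hb hb']
        simp [P, hij, Ne.symm hb, Ne.symm hb']
    by_cases ha' : j = a
    · subst ha'
      by_cases hb : i = b
      · subst hb
        rw [hflip, hzero]; simp [P]
      by_cases hb' : j = b
      · subst hb'
        rw [hdiag]; simp [P]
      · rw [hB b hb hb']
        simp [P, hij.symm, Ne.symm hb, Ne.symm hb']
    by_cases hb : i = b
    · subst hb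
      rw [hflip, hA a ha ha']
      simp [P, hij, Ne.symm ha, Ne.symm ha']
    by_cases hb' : j = b
    · subst hb'
      rw [hflip, hB a ha ha']
      simp [P, hij.symm, Ne.symm ha, Ne.symm ha']
    · rw [hdisj a b ha hb ha' hb']
      simp [P, Ne.symm ha, Ne.symm ha', Ne.symm hb, Ne.symm hb']
  refine ⟨M, ?_⟩
  have hsum : ∑ a, ∑ b, P b a < 0 := by
    have hcol : ∀ b, ∑ a, P a b = if b = i ∨ b = j then 0 else -1 / 2 := by
      intro b
      by_cases hb : b = i ∨ b = j
      · simp [P, hb]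
      · simp only [P, hb, if_false, Finset.sum_add_distrib, Finset.sum_ite_eq', Finset.mem_univ,
          if_true]
        norm_num
    simp only [hcol]
    refine Finset.sum_neg' (fun b _ => by split_ifs <;> norm_num) ⟨k, Finset.mem_univ k, ?_⟩
    rw [if_neg (by simp [hik.symm, hjk.symm])]
    norm_num
  rw [ricci, trace_eq_sum]
  simp only [hF, Finset.sum_add_distrib]
  rw [Finset.sum_comm (f := fun a b => P a b)]
  linarith

end RigidBodyMetric

end GenRigidBody

end

theorem mainTheorem6 (n : ℕ) (hn : 3 ≤ n) :
    (∀ M : GenRigidBody.RigidBodyMetric n,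
      (∀ u₀ : GenRigidBody.SoAlg n, ∃! γ : ℝ → GenRigidBody.SOGroup n, M.IsGeodesicFrom γ u₀) ∧
      ∀ i j : Fin n, i < j →
        M.IsSteady (GenRigidBody.e i j) ∧
        ∃ τ : ℝ, 0 < τ ∧ M.IsConjugateTime (GenRigidBody.e i j) τ) ∧
    ∃ M : GenRigidBody.RigidBodyMetric n, ∃ i j : Fin n, i < j ∧
      M.ricci (GenRigidBody.e i j) (GenRigidBody.e i j) < 0 := by
  refine ⟨fun M => ⟨M.existsUnique_isGeodesicFrom, fun i j hij => ⟨?_, ?_⟩⟩, ?_⟩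
  · obtain ⟨c, hc⟩ := M.eigen i j hij
    exact M.isSteady_of_op_eq_smul hc
  · obtain ⟨k, hk⟩ : ∃ k : Fin n, k ∉ ({i, j} : Finset (Fin n)) := by
      by_contra! h
      have h1 := Finset.card_le_card (fun x _ => h x : Finset.univ ⊆ ({i, j} : Finset (Fin n)))
      have h2 := Finset.card_le_two (a := i) (b := j)
      rw [Finset.card_univ, Fintype.card_fin] at h1
      omega
    simp only [Finset.mem_insert, Finset.mem_singleton, not_or] at hk
    exact M.exists_isConjugateTime hij.ne (Ne.symm hk.1) (Ne.symm hk.2)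
  · obtain ⟨M, hM⟩ := GenRigidBody.RigidBodyMetric.exists_ricci_neg (⟨0, by omega⟩ : Fin n)
      ⟨1, by omega⟩ ⟨2, by omega⟩ (by simp) (by simp) (by simp)
    exact ⟨M, _, _, by simp, hM⟩
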